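/- Let $\mathfrak g=\mathfrak g_{\bar 0}\oplus\mathfrak g_{\bar 1}$ be a finite-dimensional simple Lie superalgebra over $\mathbb C$ with a nondegenerate invariant even supersymmetric bilinear form $(\,|\,)$, let $(e,h,f)$ be an $\mathfrak{sl}_2$-triple of even elements of $\mathfrak g$ with $(e|f)=\tfrac12(h|h)=1$, and let $k\in\mathbb C$. Let $\mathfrak g(i)$ be the eigenspace of $\operatorname{ad}\frac h2$ with eigenvalue $i$, and put $\mathfrak n=\bigoplus_{i>0}\mathfrak g(i)$, $\mathfrak m=\bigoplus_{i\ge1}\mathfrak g(i)$, $\mathfrak p=\bigoplus_{i<1}\mathfrak g(i)$, $\mathfrak m^\perp=\{w\in\mathfrak g:(w|m)=0\ \forall m\in\mathfrak m\}$. Let $\mathcal P=S(\mathbb C[\partial]\otimes\mathfrak g)$ be the supersymmetric algebra with its even derivation $\partial$ and with the $\lambda$-bracket determined by $\{a_\lambda b\}=[a,b]+k\lambda(a|b)$ for $a,b\in\mathfrak g$, sesquilinearity and the Leibniz rules. Let $\mathcal I\subset\mathcal P$ be the differential ideal generated by the elements $m+(f|m)$, $m\in\mathfrak m$, and let $\mathcal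 V_{\mathcal I}(\mathfrak p)=\mathcal P/\mathcal I$. The classical affine W-superalgebra is $$\mathcal W(\mathfrak g,f,k)=(\mathcal P/\mathcal I)^{\operatorname{ad}_\lambda\mathfrak n}=\{A+\mathcal I:\ \{n_\lambda A\}\in\mathcal I[\lambda]\ \text{for all } n\in\mathfrak n\}.$$ Equip $\mathfrak g\otimes\mathcal V_{\mathcal I}(\mathfrak p)$ with the bracket $[a\otimes F,b\otimes G]=(-1)^{p(b)p(F)}[a,b]\otimes FG$ and with $\partial(a\otimes F)=a\otimes\partial F$, and form the semidirect product $\mathbb C\partial\ltimes(\mathfrak g\otimes\mathcal V_{\mathcal I}(\mathfrak p))$. Let $\mathcal F=(\mathfrak m^\perp\otimes\mathcal V_{\mathcal I}(\mathfrak p))_{\bar0}$. Two elements $q,q'\in\mathcal F$ are gauge equivalent if there is $X\in(\mathfrak n\otimes\mathcal V_{\mathcal I}(\mathfrak p))_{\bar0}$ with $$e^{\operatorname{ad}X}(k\partial+q-f\otimes1)=k\partial+q'-f\otimes1$$ (the exponential being a finite sum). Each $P\in\mathcal V_{\mathcal I}(\mathfrak p)$ is regarded as a function $q\mapsto P(q)$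 from $\mathcal F$ to $\mathcal V_{\mathcal I}(\mathfrak p)$: for fixed $q$ the map $P\mapsto P(q)$ is the unital algebra homomorphism that commutes with $\partial$ and satisfies $p(q)=\sum_j(a_j|p)F_j$ for $p\in\mathfrak p$ and $q=\sum_j a_j\otimes F_j$. Call $P$ gauge invariant if $P(q)=P(q')$ whenever $q,q'\in\mathcal F$ are gauge equivalent. Then the subalgebra of gauge invariant elements of $\mathcal V_{\mathcal I}(\mathfrak p)$ is equal to $\mathcal W(\mathfrak g,f,k)$. -/

import Mathlib

open scoped TensorProduct

namespace DrinfeldSokolov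

open Polynomial (X C)

/-- The sign `(-1)^{ij}` attached to two parities. -/
noncomputable def superSign (i j : ZMod 2) : ℂ := (-1) ^ (i.val * j.val)

theorem superSign_zero_left (j : ZMod 2) : superSign 0 j = 1 := by simp [superSign]

theorem superSign_zero_right (j : ZMod 2) : superSign j 0 = 1 := by simp [superSign]

theorem superSign_one_one : superSign 1 1 = -1 := by
  have : (1 : ZMod 2).val = 1 := rfl
  simp [superSign, this]

theorem superSign_comm (i j : ZMod 2) : superSign i j = superSign j i := by
  simp [superSign, mul_comm]

theorem superSign_mul_self (i j : ZMod 2) : superSign i j * superSign i j = 1 := by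
  simp [superSign, ← mul_pow]

theorem superSign_add (i j l : ZMod 2) :
    superSign (i + j) l = superSign i l * superSign j l := by
  have h : ∀ x : ZMod 2, x = 0 ∨ x = 1 := by decide
  have h2 : (1 + 1 : ZMod 2) = 0 := by decide
  rcases h i with rfl | rfl <;> rcases h j with rfl | rfl <;> rcases h l with rfl | rfl <;>
    simp [superSign_zero_left, superSign_zero_right, superSign_one_one, h2]

/-- A complex Lie superalgebra `g = g_0 ⊕ g_1`; `comp i` is the subspace of elements of parity `i`
and `br` is the bracket. -/
class LieSuperalgebra (g : Type*) [AddCommGroup g] [Module ℂ g] where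
  comp : ZMod 2 → Submodule ℂ g
  isCompl : IsCompl (comp 0) (comp 1)
  br : g →ₗ[ℂ] g →ₗ[ℂ] g
  br_mem : ∀ {i j : ZMod 2} {a b : g}, a ∈ comp i → b ∈ comp j → br a b ∈ comp (i + j)
  br_skew : ∀ {i j : ZMod 2} {a b : g}, a ∈ comp i → b ∈ comp j →
    br a b = -(superSign i j • br b a)
  br_jacobi : ∀ {i j : ZMod 2} {a b : g}, a ∈ comp i → b ∈ comp j → ∀ c : g,
    br a (br b c) = br (br a b) c + superSign i j • br b (br a c)

section Lie

variable {g : Type*} [AddCommGroup g] [Module ℂ g] [LieSuperalgebra g]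

/-- The projection of `g` onto its component of parity `i`. -/
noncomputable def proj (i : ZMod 2) : g →ₗ[ℂ] g :=
  if i = 0 then Submodule.projection _ _ (LieSuperalgebra.isCompl (g := g))
  else Submodule.projection _ _ (LieSuperalgebra.isCompl (g := g)).symm

/-- The parity involution of `g`: multiplication by `(-1)^i` on the component of parity `i`. -/
noncomputable def parityInv : g →ₗ[ℂ] g := proj 0 - proj 1

theorem zmod2_cases (i : ZMod 2) : i = 0 ∨ i = 1 := by
  revert i; decide

theorem proj_mem (i : ZMod 2) (a : g) : proj i a ∈ LieSuperalgebra.comp (g := g) i := by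
  rcases zmod2_cases i with rfl | rfl <;> simp [proj]

theorem proj_add (a : g) : proj 0 a + proj 1 a = a := by
  simp only [proj, if_true, one_ne_zero, if_false]
  exact Submodule.projection_add_projection_eq_self _ a

theorem proj_self {i : ZMod 2} {a : g} (ha : a ∈ LieSuperalgebra.comp (g := g) i) :
    proj i a = a := by
  rcases zmod2_cases i with rfl | rfl <;> simp [proj, ha]

theorem proj_of_ne {i j : ZMod 2} (hij : i ≠ j) {a : g}
    (ha : a ∈ LieSuperalgebra.comp (g := g) j) : proj i a = 0 := by
  rcases zmod2_cases i with rfl | rfl <;> rcases zmod2_cases j with rfl | rfl <;>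
    simp_all [proj]

theorem parityInv_of_mem {i : ZMod 2} {a : g} (ha : a ∈ LieSuperalgebra.comp (g := g) i) :
    parityInv a = superSign 1 i • a := by
  rcases zmod2_cases i with rfl | rfl
  · simp [parityInv, proj_self ha, proj_of_ne one_ne_zero ha, superSign_zero_right]
  · simp [parityInv, proj_self ha, proj_of_ne zero_ne_one ha, superSign_one_one]

variable (g) in
/-- `g` is simple: its bracket is nonzero and it has no graded ideals besides `0` and `g`. -/
def IsSimple : Prop :=
  (∃ a b : g, LieSuperalgebra.br a b ≠ 0) ∧
  ∀ J : Submodule ℂ g, (∀ i, ∀ a ∈ J, proj i a ∈ J) →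
    (∀ x, ∀ a ∈ J, LieSuperalgebra.br x a ∈ J) → J = ⊥ ∨ J = ⊤

end Lie

/-- An even supersymmetric nondegenerate invariant bilinear form `( | )` on `g` and an
`sl_2`-triple `(e, h, f)` of even elements, normalized by `(e|f) = (h|h)/2 = 1`. -/
structure Setup (g : Type*) [AddCommGroup g] [Module ℂ g] [LieSuperalgebra g] where
  form : LinearMap.BilinForm ℂ g
  form_even : ∀ {i j : ZMod 2} {a b : g}, a ∈ LieSuperalgebra.comp i →
    b ∈ LieSuperalgebra.comp j → i ≠ j → form a b = 0
  form_symm : ∀ {i j : ZMod 2} {a b : g}, a ∈ LieSuperalgebra.comp i →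
    b ∈ LieSuperalgebra.comp j → form a b = superSign i j * form b a
  form_invariant : ∀ a b c : g,
    form (LieSuperalgebra.br a b) c = form a (LieSuperalgebra.br b c)
  form_nondegenerate : form.Nondegenerate
  e : g
  h : g
  f : g
  e_even : e ∈ LieSuperalgebra.comp (g := g) 0
  h_even : h ∈ LieSuperalgebra.comp (g := g) 0
  f_even : f ∈ LieSuperalgebra.comp (g := g) 0
  br_e_f : LieSuperalgebra.br e f = h
  br_h_e : LieSuperalgebra.br h e = (2 : ℂ) • e
  br_h_f : LieSuperalgebra.br h f = (-2 : ℂ) • f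
  form_e_f : form e f = 1
  form_h_h : form h h = 2

namespace Setup

variable {g : Type*} [AddCommGroup g] [Module ℂ g] [LieSuperalgebra g] (D : Setup g)

/-- `g(i)`, the eigenspace of `ad (h/2)` of eigenvalue `i`. -/
noncomputable def gr (i : ℚ) : Submodule ℂ g :=
  Module.End.eigenspace ((1 / 2 : ℂ) • LieSuperalgebra.br D.h) (i : ℂ)

/-- `𝔫 = ⨁_{i > 0} g(i)`. -/
noncomputable def nn : Submodule ℂ g := ⨆ i : {i : ℚ // 0 < i}, D.gr i

/-- `𝔪 = ⨁_{i ≥ 1} g(i)`. -/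
noncomputable def mm : Submodule ℂ g := ⨆ i : {i : ℚ // 1 ≤ i}, D.gr i

/-- `𝔭 = ⨁_{i < 1} g(i)`. -/
noncomputable def pp : Submodule ℂ g := ⨆ i : {i : ℚ // i < 1}, D.gr i

/-- `𝔪^⊥ = {w | (w|v) = 0 for all v ∈ 𝔪}`. -/
noncomputable def mperp : Submodule ℂ g where
  carrier := {w | ∀ v ∈ D.mm, D.form w v = 0}
  add_mem' := by
    intro a b ha hb v hv
    simp [ha v hv, hb v hv]
  zero_mem' := by
    intro v _
    simp
  smul_mem' := by
    intro c a ha v hv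
    simp [ha v hv]

theorem proj_mem_gr (i : ℚ) (j : ZMod 2) {a : g} (ha : a ∈ D.gr i) : proj j a ∈ D.gr i := by
  have key : ∀ b : g, LieSuperalgebra.br D.h (proj j b) = proj j (LieSuperalgebra.br D.h b) := by
    intro b
    have h0 := LieSuperalgebra.br_mem D.h_even (proj_mem 0 b)
    have h1 := LieSuperalgebra.br_mem D.h_even (proj_mem 1 b)
    simp only [zero_add] at h0 h1
    conv_rhs => rw [← proj_add b, map_add, map_add]
    rcases zmod2_cases j with rfl | rfl
    · rw [proj_self h0, proj_of_ne zero_ne_one h1, add_zero]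
    · rw [proj_self h1, proj_of_ne one_ne_zero h0, zero_add]
  rw [gr, Module.End.mem_eigenspace_iff] at ha ⊢
  rw [LinearMap.smul_apply, key, ← map_smul, ← LinearMap.smul_apply, ha, map_smul]

theorem proj_mem_mm (j : ZMod 2) {a : g} (ha : a ∈ D.mm) : proj j a ∈ D.mm := by
  have : D.mm ≤ D.mm.comap (proj j) := by
    refine iSup_le fun i => ?_
    intro x hx
    exact (le_iSup (fun i : {i : ℚ // 1 ≤ i} => D.gr i) i) (D.proj_mem_gr i j hx)
  exact this ha

theorem form_f_odd {a : g} (ha : a ∈ LieSuperalgebra.comp (g := g) 1) : D.form D.f a = 0 :=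
  D.form_even D.f_even ha zero_ne_one

/-- `f` is orthogonal to `𝔭`. -/
theorem form_f_pp {a : g} (ha : a ∈ D.pp) : D.form D.f a = 0 := by
  have : D.pp ≤ LinearMap.ker (D.form D.f) := by
    refine iSup_le fun i => ?_
    intro x hx
    rw [LinearMap.mem_ker]
    rw [gr, Module.End.mem_eigenspace_iff, LinearMap.smul_apply] at hx
    have h1 : D.form D.f (LieSuperalgebra.br D.h x) = 2 * (i : ℂ) * D.form D.f x := by
      have : LieSuperalgebra.br D.h x = (2 * (i : ℂ)) • x := by
        rw [mul_smul, ← hx, smul_smul]; norm_num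
      rw [this]; simp
    have h2 : LieSuperalgebra.br D.f D.h = (2 : ℂ) • D.f := by
      rw [LieSuperalgebra.br_skew D.f_even D.h_even, superSign_zero_left, D.br_h_f]
      simp
    rw [← D.form_invariant, h2] at h1
    simp only [map_smul, LinearMap.smul_apply, smul_eq_mul] at h1
    have h3 : (1 - (i : ℂ)) * D.form D.f x = 0 := by linear_combination h1 / 2
    rcases mul_eq_zero.1 h3 with h | h
    · exfalso
      have h4 : ((i : ℚ) : ℂ) = ((1 : ℚ) : ℂ) := by push_cast; linear_combination -h
      have h5 := Rat.cast_injective h4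
      have := i.2
      rw [h5] at this
      exact lt_irrefl _ this
    · exact h
  exact this ha

end Setup

section Affine

variable (g : Type*) [AddCommGroup g] [Module ℂ g] [LieSuperalgebra g]

/-- The space `ℂ[∂] ⊗ g`; the variable `X` of `ℂ[X]` plays the role of `∂`. -/
abbrev Gens : Type _ := Polynomial ℂ ⊗[ℂ] g

/-- The relations `xy = (-1)^{p(x)p(y)} yx` for homogeneous `x, y ∈ ℂ[∂] ⊗ g`. -/
inductive CommRel : TensorAlgebra ℂ (Gens g) → TensorAlgebra ℂ (Gens g) → Prop
  | swap {i j : ZMod 2} {a b : g} (ha : a ∈ LieSuperalgebra.comp i)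
      (hb : b ∈ LieSuperalgebra.comp j) (u v : Polynomial ℂ) :
      CommRel (TensorAlgebra.ι ℂ (u ⊗ₜ[ℂ] a) * TensorAlgebra.ι ℂ (v ⊗ₜ[ℂ] b))
        (superSign i j • (TensorAlgebra.ι ℂ (v ⊗ₜ[ℂ] b) * TensorAlgebra.ι ℂ (u ⊗ₜ[ℂ] a)))

/-- The supersymmetric algebra `S(ℂ[∂] ⊗ g)`. -/
def Aff : Type _ := RingQuot (CommRel g)

noncomputable instance : Ring (Aff g) := inferInstanceAs (Ring (RingQuot (CommRel g)))

noncomputable instance : Algebra ℂ (Aff g) :=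
  inferInstanceAs (Algebra ℂ (RingQuot (CommRel g)))

namespace Aff

/-- The inclusion `ℂ[∂] ⊗ g → S(ℂ[∂] ⊗ g)`. -/
noncomputable def gen : Gens g →ₗ[ℂ] Aff g :=
  (RingQuot.mkAlgHom ℂ (CommRel g)).toLinearMap ∘ₗ TensorAlgebra.ι ℂ

variable {g}

/-- The inclusion `g → S(ℂ[∂] ⊗ g)`. -/
noncomputable def incl (a : g) : Aff g := gen g (1 ⊗ₜ[ℂ] a)

variable {Q : Type*} [Ring Q] [Algebra ℂ Q]

/-- The values of `φ` supercommute. -/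
def IsSuperComm (φ : Gens g →ₗ[ℂ] Q) : Prop :=
  ∀ ⦃i j : ZMod 2⦄ ⦃a b : g⦄, a ∈ LieSuperalgebra.comp (g := g) i →
    b ∈ LieSuperalgebra.comp (g := g) j → ∀ u v : Polynomial ℂ,
      φ (u ⊗ₜ a) * φ (v ⊗ₜ b) = superSign i j • (φ (v ⊗ₜ b) * φ (u ⊗ₜ a))

theorem gen_superComm : IsSuperComm (gen g) := by
  intro i j a b ha hb u v
  have := RingQuot.mkAlgHom_rel ℂ (CommRel.swap ha hb u v)
  rw [map_mul, map_smul, map_mul] at this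
  exact this

/-- The universal property of `S(ℂ[∂] ⊗ g)`. -/
noncomputable def lift (φ : Gens g →ₗ[ℂ] Q) (hφ : IsSuperComm φ) : Aff g →ₐ[ℂ] Q :=
  RingQuot.liftAlgHom ℂ ⟨TensorAlgebra.lift ℂ φ, by
    rintro _ _ ⟨ha, hb, u, v⟩
    simpa using hφ ha hb u v⟩

theorem lift_gen (φ : Gens g →ₗ[ℂ] Q) (hφ : IsSuperComm φ) (x : Gens g) :
    lift φ hφ (gen g x) = φ x := by
  have := RingQuot.liftAlgHom_mkAlgHom_apply ℂ (TensorAlgebra.lift ℂ φ)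
    (s := CommRel g) (by
      rintro _ _ ⟨ha, hb, u, v⟩
      simpa using hφ ha hb u v) (TensorAlgebra.ι ℂ x)
  rw [TensorAlgebra.lift_ι_apply] at this
  exact this

theorem induction {P : Aff g → Prop} (h_alg : ∀ c : ℂ, P (algebraMap ℂ _ c))
    (h_gen : ∀ (i : ZMod 2) (a : g), a ∈ LieSuperalgebra.comp (g := g) i →
      ∀ u : Polynomial ℂ, P (gen g (u ⊗ₜ a)))
    (h_mul : ∀ x y, P x → P y → P (x * y)) (h_add : ∀ x y, P x → P y → P (x + y))
    (x : Aff g) : P x := by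
  obtain ⟨t, rfl⟩ := RingQuot.mkAlgHom_surjective ℂ (CommRel g) x
  induction t using TensorAlgebra.induction with
  | algebraMap r => rw [AlgHom.commutes]; exact h_alg r
  | ι m =>
    induction m using TensorProduct.induction_on with
    | zero =>
      rw [map_zero, map_zero]
      have := h_alg 0
      rwa [map_zero] at this
    | tmul u a =>
      rw [← proj_add a, TensorProduct.tmul_add, map_add, map_add]
      exact h_add _ _ (h_gen 0 _ (proj_mem 0 a) u) (h_gen 1 _ (proj_mem 1 a) u)
    | add m m' hm hm' =>
      rw [map_add, map_add]
      exact h_add _ _ hm hm'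
  | mul x y hx hy => rw [map_mul]; exact h_mul _ _ hx hy
  | add x y hx hy => rw [map_add]; exact h_add _ _ hx hy

theorem hom_ext {φ ψ : Aff g →ₐ[ℂ] Q} (h : ∀ (u : Polynomial ℂ) (a : g),
    φ (gen g (u ⊗ₜ a)) = ψ (gen g (u ⊗ₜ a))) (x : Aff g) : φ x = ψ x := by
  induction x using induction with
  | h_alg c => rw [AlgHom.commutes, AlgHom.commutes]
  | h_gen i a ha u => exact h u a
  | h_mul x y hx hy => rw [map_mul, map_mul, hx, hy]
  | h_add x y hx hy => rw [map_add, map_add, hx, hy]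

/-- The upper triangular matrix `((s, d), (0, t))`. -/
noncomputable def upper (s t : Aff g →ₐ[ℂ] Q) (d : Gens g →ₗ[ℂ] Q) :
    Gens g →ₗ[ℂ] Matrix (Fin 2) (Fin 2) Q where
  toFun x := !![s (gen g x), d x; 0, t (gen g x)]
  map_add' x y := by
    ext i j
    fin_cases i <;> fin_cases j <;> simp
  map_smul' c x := by
    ext i j
    fin_cases i <;> fin_cases j <;> simp

/-- The compatibility of `d` with the relations of `S(ℂ[∂] ⊗ g)` that is needed to extend `d` to
a derivation. -/
def IsCompat (s t : Aff g →ₐ[ℂ] Q) (d : Gens g →ₗ[ℂ] Q) : Prop :=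
  ∀ ⦃i j : ZMod 2⦄ ⦃a b : g⦄, a ∈ LieSuperalgebra.comp (g := g) i →
    b ∈ LieSuperalgebra.comp (g := g) j → ∀ u v : Polynomial ℂ,
      s (gen g (u ⊗ₜ a)) * d (v ⊗ₜ b) + d (u ⊗ₜ a) * t (gen g (v ⊗ₜ b)) =
        superSign i j • (s (gen g (v ⊗ₜ b)) * d (u ⊗ₜ a) + d (v ⊗ₜ b) * t (gen g (u ⊗ₜ a)))

theorem upper_superComm {s t : Aff g →ₐ[ℂ] Q} {d : Gens g →ₗ[ℂ] Q} (h : IsCompat s t d) :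
    IsSuperComm (upper s t d) := by
  intro i j a b ha hb u v
  have hs := congrArg s (gen_superComm ha hb u v)
  have ht := congrArg t (gen_superComm ha hb u v)
  rw [map_mul, map_smul, map_mul] at hs ht
  have hd := h ha hb u v
  ext k l
  fin_cases k <;> fin_cases l <;>
    simp [upper, Matrix.mul_apply, Fin.sum_univ_two, hs, ht, hd]

/-- The linear map `∇ : S(ℂ[∂] ⊗ g) → Q` that extends `d` by the rule
`∇(xy) = s(x) ∇(y) + ∇(x) t(y)`. -/
noncomputable def twistedDer (s t : Aff g →ₐ[ℂ] Q) (d : Gens g →ₗ[ℂ] Q) (h : IsCompat s t d) :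
    Aff g →ₗ[ℂ] Q :=
  Matrix.entryLinearMap ℂ Q 0 1 ∘ₗ (lift (upper s t d) (upper_superComm h)).toLinearMap

section
variable (s t : Aff g →ₐ[ℂ] Q) (d : Gens g →ₗ[ℂ] Q) (h : IsCompat s t d)

theorem lift_upper (x : Aff g) :
    lift (upper s t d) (upper_superComm h) x = !![s x, twistedDer s t d h x; 0, t x] := by
  have key : lift (upper s t d) (upper_superComm h) x 0 0 = s x ∧
      lift (upper s t d) (upper_superComm h) x 1 0 = 0 ∧
      lift (upper s t d) (upper_superComm h) x 1 1 = t x := by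
    induction x using induction with
    | h_alg c =>
      simp only [AlgHom.commutes, Matrix.algebraMap_matrix_apply]
      simp
    | h_gen i a ha u =>
      rw [lift_gen]
      simp [upper]
    | h_mul x y hx hy =>
      obtain ⟨hx1, hx2, hx3⟩ := hx
      obtain ⟨hy1, hy2, hy3⟩ := hy
      simp [Matrix.mul_apply, Fin.sum_univ_two, hx1, hx2, hx3, hy1, hy2, hy3]
    | h_add x y hx hy =>
      obtain ⟨hx1, hx2, hx3⟩ := hx
      obtain ⟨hy1, hy2, hy3⟩ := hy
      simp [hx1, hx2, hx3, hy1, hy2, hy3]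
  obtain ⟨h1, h2, h3⟩ := key
  ext k l
  fin_cases k <;> fin_cases l
  · exact h1
  · rfl
  · exact h2
  · exact h3

theorem twistedDer_gen (x : Gens g) : twistedDer s t d h (gen g x) = d x := by
  simp [twistedDer, lift_gen, upper]

theorem twistedDer_mul (x y : Aff g) :
    twistedDer s t d h (x * y) = s x * twistedDer s t d h y + twistedDer s t d h x * t y := by
  have := congrFun (congrFun (map_mul (lift (upper s t d) (upper_superComm h)) x y) 0) 1
  rw [lift_upper, lift_upper, lift_upper] at this
  simpa [Matrix.mul_apply, Fin.sum_univ_two] using this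

theorem twistedDer_algebraMap (c : ℂ) : twistedDer s t d h (algebraMap ℂ _ c) = 0 := by
  simp [twistedDer, Matrix.algebraMap_matrix_apply]

end

/-- Multiplication by `∂` on `ℂ[∂] ⊗ g`. -/
noncomputable def shift : Gens g →ₗ[ℂ] Gens g :=
  LinearMap.rTensor g (LinearMap.mulLeft ℂ (X : Polynomial ℂ))

set_option linter.unusedSectionVars false in
theorem shift_tmul (u : Polynomial ℂ) (a : g) : shift (u ⊗ₜ[ℂ] a) = (X * u) ⊗ₜ[ℂ] a := by
  simp [shift]

theorem deriv_compat : IsCompat (AlgHom.id ℂ (Aff g)) (AlgHom.id ℂ (Aff g)) (gen g ∘ₗ shift) := by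
  intro i j a b ha hb u v
  simp only [AlgHom.coe_id, id_eq, LinearMap.comp_apply, shift_tmul]
  rw [gen_superComm ha hb, gen_superComm ha hb, smul_add, add_comm]

/-- The even derivation `∂` of the differential superalgebra `S(ℂ[∂] ⊗ g)`. -/
noncomputable def deriv : Aff g →ₗ[ℂ] Aff g :=
  twistedDer (AlgHom.id ℂ _) (AlgHom.id ℂ _) (gen g ∘ₗ shift) deriv_compat

theorem deriv_gen (u : Polynomial ℂ) (a : g) :
    deriv (gen g (u ⊗ₜ a)) = gen g ((X * u) ⊗ₜ a) := by
  simp [deriv, twistedDer_gen, shift_tmul]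

theorem deriv_mul (x y : Aff g) : deriv (x * y) = x * deriv y + deriv x * y :=
  twistedDer_mul _ _ _ _ x y

theorem deriv_algebraMap (c : ℂ) : deriv (algebraMap ℂ (Aff g) c) = 0 :=
  twistedDer_algebraMap _ _ _ _ c

theorem sigma_compat : IsSuperComm (gen g ∘ₗ LinearMap.lTensor (Polynomial ℂ) parityInv) := by
  intro i j a b ha hb u v
  simp only [LinearMap.comp_apply, LinearMap.lTensor_tmul, parityInv_of_mem ha,
    parityInv_of_mem hb, TensorProduct.tmul_smul, map_smul, smul_mul_smul_comm]
  rw [gen_superComm ha hb, smul_comm, mul_comm (superSign 1 i)]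

/-- The parity involution of `S(ℂ[∂] ⊗ g)`: multiplication by `(-1)^{p(A)}` on homogeneous `A`. -/
noncomputable def sigma : Aff g →ₐ[ℂ] Aff g :=
  lift (gen g ∘ₗ LinearMap.lTensor (Polynomial ℂ) parityInv) sigma_compat

theorem sigma_gen {i : ZMod 2} {a : g} (ha : a ∈ LieSuperalgebra.comp (g := g) i)
    (u : Polynomial ℂ) : sigma (gen g (u ⊗ₜ a)) = superSign 1 i • gen g (u ⊗ₜ a) := by
  simp [sigma, lift_gen, parityInv_of_mem ha]

theorem sigma_sigma (x : Aff g) : sigma (sigma x) = x := by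
  induction x using induction with
  | h_alg c => rw [AlgHom.commutes, AlgHom.commutes]
  | h_gen i a ha u =>
    rw [sigma_gen ha, map_smul, sigma_gen ha, smul_smul, superSign_mul_self, one_smul]
  | h_mul x y hx hy => rw [map_mul, map_mul, hx, hy]
  | h_add x y hx hy => rw [map_add, map_add, hx, hy]

theorem sigma_deriv (x : Aff g) : sigma (deriv x) = deriv (sigma x) := by
  induction x using induction with
  | h_alg c => rw [AlgHom.commutes, deriv_algebraMap, map_zero]
  | h_gen i a ha u =>
    rw [sigma_gen ha, map_smul, deriv_gen, sigma_gen ha]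
  | h_mul x y hx hy =>
    rw [deriv_mul, map_mul, deriv_mul, map_add, map_mul, map_mul, hx, hy]
  | h_add x y hx hy => rw [map_add, map_add, map_add, map_add, hx, hy]

/-- `x ↦ (-1)^{i p(x)} x`. -/
noncomputable def sigmaPow (i : ZMod 2) : Aff g →ₐ[ℂ] Aff g :=
  if i = 0 then AlgHom.id ℂ _ else sigma

theorem sigmaPow_gen (j : ZMod 2) {i : ZMod 2} {a : g}
    (ha : a ∈ LieSuperalgebra.comp (g := g) i) (u : Polynomial ℂ) :
    sigmaPow j (gen g (u ⊗ₜ a)) = superSign j i • gen g (u ⊗ₜ a) := by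
  rcases zmod2_cases j with rfl | rfl
  · simp [sigmaPow, superSign_zero_left]
  · simp [sigmaPow, sigma_gen ha]

/-- The homogeneous elements of parity `i` of `S(ℂ[∂] ⊗ g)`. -/
noncomputable def comp (i : ZMod 2) : Submodule ℂ (Aff g) :=
  LinearMap.ker (sigma.toLinearMap - superSign 1 i • LinearMap.id)

theorem mem_comp {i : ZMod 2} {x : Aff g} : x ∈ comp i ↔ sigma x = superSign 1 i • x := by
  simp [comp, sub_eq_zero]

theorem sigmaPow_of_mem (j : ZMod 2) {i : ZMod 2} {x : Aff g} (hx : x ∈ comp i) :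
    sigmaPow j x = superSign j i • x := by
  rcases zmod2_cases j with rfl | rfl
  · simp [sigmaPow, superSign_zero_left]
  · simpa [sigmaPow] using mem_comp.1 hx

theorem gen_mem_comp {i : ZMod 2} {a : g} (ha : a ∈ LieSuperalgebra.comp (g := g) i)
    (u : Polynomial ℂ) : gen g (u ⊗ₜ a) ∈ comp i := mem_comp.2 (sigma_gen ha u)

theorem deriv_mem_comp {i : ZMod 2} {x : Aff g} (hx : x ∈ comp i) : deriv x ∈ comp i := by
  rw [mem_comp] at hx ⊢
  rw [sigma_deriv, hx, map_smul]

theorem algebraMap_mem_comp (c : ℂ) : algebraMap ℂ (Aff g) c ∈ comp 0 := by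
  rw [mem_comp, AlgHom.commutes, superSign_zero_right, one_smul]

theorem gen_mul {i : ZMod 2} {a : g} (ha : a ∈ LieSuperalgebra.comp (g := g) i)
    (u : Polynomial ℂ) (y : Aff g) :
    gen g (u ⊗ₜ a) * y = sigmaPow i y * gen g (u ⊗ₜ a) := by
  induction y using induction with
  | h_alg c => rw [AlgHom.commutes]; exact (Algebra.commutes c _).symm
  | h_gen j b hb v =>
    rw [sigmaPow_gen i hb, gen_superComm ha hb, smul_mul_assoc]
  | h_mul x y hx hy => rw [map_mul, ← mul_assoc, hx, mul_assoc, hy, mul_assoc]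
  | h_add x y hx hy => rw [map_add, mul_add, add_mul, hx, hy]

/-- `S(ℂ[∂] ⊗ g)` is supercommutative. -/
theorem superComm {i j : ZMod 2} {x y : Aff g} (hx : x ∈ comp i) (hy : y ∈ comp j) :
    x * y = superSign i j • (y * x) := by
  have key : ∀ z : Aff g, z * y = y * sigmaPow j z := by
    intro z
    induction z using induction with
    | h_alg c => rw [AlgHom.commutes]; exact Algebra.commutes c _
    | h_gen l b hb v =>
      rw [sigmaPow_gen j hb, gen_mul hb, sigmaPow_of_mem l hy, smul_mul_assoc, mul_smul_comm,
        superSign_comm]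
    | h_mul x y hx hy => rw [map_mul, mul_assoc, hy, ← mul_assoc, hx, mul_assoc]
    | h_add x y hx hy => rw [map_add, mul_add, add_mul, hx, hy]
  rw [key, sigmaPow_of_mem j hx, mul_smul_comm, superSign_comm]

end Aff

section Lambda

variable {g : Type*} [AddCommGroup g] [Module ℂ g] [LieSuperalgebra g]

/-- Apply a linear map to every coefficient of a polynomial. -/
noncomputable def coeffwise {A B : Type*} [Ring A] [Algebra ℂ A] [Ring B] [Algebra ℂ B]
    (T : A →ₗ[ℂ] B) : Polynomial A →ₗ[ℂ] Polynomial B :=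
  Polynomial.lsum fun n => ((Polynomial.monomial n).restrictScalars ℂ : B →ₗ[ℂ] Polynomial B) ∘ₗ T

theorem coeff_coeffwise {A B : Type*} [Ring A] [Algebra ℂ A] [Ring B] [Algebra ℂ B]
    (T : A →ₗ[ℂ] B) (p : Polynomial A) (n : ℕ) : (coeffwise T p).coeff n = T (p.coeff n) := by
  induction p using Polynomial.induction_on' with
  | add p q hp hq => rw [map_add, Polynomial.coeff_add, hp, hq, Polynomial.coeff_add, map_add]
  | monomial m a =>
    have : coeffwise T (Polynomial.monomial m a) = Polynomial.monomial m (T a) := by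
      simp [coeffwise, Polynomial.lsum, Polynomial.sum_monomial_index]
    rw [this, Polynomial.coeff_monomial, Polynomial.coeff_monomial]
    split_ifs <;> simp

/-- The operator `λ + ∂` on `S(ℂ[∂] ⊗ g)[λ]`; the polynomial variable is `λ`. -/
noncomputable def lamPlusDeriv : Module.End ℂ (Polynomial (Aff g)) :=
  LinearMap.mulLeft ℂ X + coeffwise Aff.deriv

/-- The polynomials in `λ` all of whose coefficients have parity `i`. -/
noncomputable def polyComp (i : ZMod 2) : Submodule ℂ (Polynomial (Aff g)) where
  carrier := {w | ∀ n, w.coeff n ∈ Aff.comp i}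
  add_mem' := by
    intro a b ha hb n
    rw [Polynomial.coeff_add]
    exact add_mem (ha n) (hb n)
  zero_mem' := by
    intro n
    rw [Polynomial.coeff_zero]
    exact zero_mem _
  smul_mem' := by
    intro c a ha n
    rw [Polynomial.coeff_smul]
    exact Submodule.smul_mem _ c (ha n)

theorem lamPlusDeriv_mem {i : ZMod 2} {w : Polynomial (Aff g)} (hw : w ∈ polyComp i) :
    lamPlusDeriv w ∈ polyComp i := by
  intro n
  simp only [lamPlusDeriv, LinearMap.add_apply, LinearMap.mulLeft_apply, Polynomial.coeff_add,
    coeff_coeffwise]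
  refine add_mem ?_ (Aff.deriv_mem_comp (hw n))
  cases n with
  | zero => simp
  | succ n => rw [Polynomial.coeff_X_mul]; exact hw n

theorem aeval_lamPlusDeriv_mem {i : ZMod 2} {w : Polynomial (Aff g)} (hw : w ∈ polyComp i)
    (u : Polynomial ℂ) : Polynomial.aeval (lamPlusDeriv (g := g)) u w ∈ polyComp i := by
  induction u using Polynomial.induction_on with
  | C c =>
    rw [Polynomial.aeval_C, Module.algebraMap_end_apply]
    exact Submodule.smul_mem _ c hw
  | add p q hp hq => rw [map_add, LinearMap.add_apply]; exact add_mem hp hq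
  | monomial n c h =>
    rw [pow_succ', mul_left_comm, map_mul, Polynomial.aeval_X, Module.End.mul_apply]
    exact lamPlusDeriv_mem h

theorem polyComp_superComm {i j : ZMod 2} {w : Polynomial (Aff g)} (hw : w ∈ polyComp i)
    {x : Aff g} (hx : x ∈ Aff.comp j) : w * C x = superSign i j • (C x * w) := by
  ext n
  rw [Polynomial.coeff_mul_C, Polynomial.coeff_smul, Polynomial.coeff_C_mul]
  exact Aff.superComm (hw n) hx

namespace Setup

variable (D : Setup g) (k : ℂ)

/-- `b ↦ {a_λ b} = [a,b] + λ k (a|b)` for `a, b ∈ g`. -/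
noncomputable def lambdaBase (a : g) : g →ₗ[ℂ] Polynomial (Aff g) where
  toFun b := C (Aff.incl (LieSuperalgebra.br a b)) + (k * D.form a b) • X
  map_add' b c := by
    simp only [Aff.incl, map_add, TensorProduct.tmul_add, mul_add, add_smul]
    abel
  map_smul' c b := by
    simp only [Aff.incl, map_smul, TensorProduct.tmul_smul, smul_add, smul_smul, smul_eq_mul,
      RingHom.id_apply, Polynomial.smul_C]
    congr 2
    ring

/-- `u(∂)b ↦ {a_λ u(∂)b} = u(λ+∂){a_λ b}` for `a, b ∈ g`. -/
noncomputable def lambdaGen (a : g) : Gens g →ₗ[ℂ] Polynomial (Aff g) :=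
  TensorProduct.lift
    ((Polynomial.aeval (lamPlusDeriv (g := g))).toLinearMap.compl₂ (D.lambdaBase k a))

theorem lambdaGen_tmul (a b : g) (u : Polynomial ℂ) :
    D.lambdaGen k a (u ⊗ₜ b) = Polynomial.aeval (lamPlusDeriv (g := g)) u (D.lambdaBase k a b) := by
  simp [lambdaGen]

theorem lambdaGen_mem {i j : ZMod 2} {a b : g} (ha : a ∈ LieSuperalgebra.comp (g := g) i)
    (hb : b ∈ LieSuperalgebra.comp (g := g) j) (u : Polynomial ℂ) :
    D.lambdaGen k a (u ⊗ₜ b) ∈ polyComp (i + j) := by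
  rw [lambdaGen_tmul]
  refine aeval_lamPlusDeriv_mem ?_ u
  refine add_mem ?_ ?_
  · intro n
    rw [Polynomial.coeff_C]
    split_ifs
    · exact Aff.gen_mem_comp (LieSuperalgebra.br_mem ha hb) 1
    · exact zero_mem _
  · by_cases hij : i = j
    · subst hij
      have h2 : i + i = 0 := by
        rcases zmod2_cases i with rfl | rfl <;> decide
      rw [h2]
      refine Submodule.smul_mem _ _ ?_
      intro n
      rw [Polynomial.coeff_X]
      split_ifs
      · have := Aff.algebraMap_mem_comp (g := g) 1
        rwa [map_one] at this
      · exact zero_mem _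
    · rw [D.form_even ha hb hij, mul_zero, zero_smul]
      exact zero_mem _

/-- The inclusion `S(ℂ[∂] ⊗ g) → S(ℂ[∂] ⊗ g)[λ]` as constant polynomials. -/
noncomputable def constPoly : Aff g →ₐ[ℂ] Polynomial (Aff g) := Polynomial.CAlgHom

theorem lambda_compat {i : ZMod 2} {a : g} (ha : a ∈ LieSuperalgebra.comp (g := g) i) :
    Aff.IsCompat (constPoly.comp (Aff.sigmaPow i)) constPoly (D.lambdaGen k a) := by
  intro j l b c hb hc u v
  have h1 := polyComp_superComm (D.lambdaGen_mem k ha hb u) (Aff.gen_mem_comp hc v)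
  have h2 := polyComp_superComm (D.lambdaGen_mem k ha hc v) (Aff.gen_mem_comp hb u)
  simp only [constPoly, AlgHom.comp_apply, Polynomial.CAlgHom_apply, Aff.sigmaPow_gen i hb,
    Aff.sigmaPow_gen i hc, h1, h2, superSign_add, ← Polynomial.smul_C, smul_mul_assoc, smul_add,
    smul_smul]
  rw [add_comm]
  congr 2
  · ring
  · rw [mul_left_comm, superSign_comm l j, superSign_mul_self, mul_one]

/-- The operator `A ↦ {a_λ A}` on the affine Poisson vertex algebra, for `a ∈ g` of parity `i`
(the component of parity `i` is taken): it is determined by `{a_λ b} = [a,b] + λ k (a|b)`,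
`{a_λ ∂A} = (λ+∂){a_λ A}` and the Leibniz rule
`{a_λ AB} = (-1)^{p(a)p(A)} A {a_λ B} + {a_λ A} B`. -/
noncomputable def adLambdaComp (i : ZMod 2) (a : g) : Aff g →ₗ[ℂ] Polynomial (Aff g) :=
  Aff.twistedDer (constPoly.comp (Aff.sigmaPow i)) constPoly (D.lambdaGen k (proj i a))
    (D.lambda_compat k (proj_mem i a))

/-- The operator `ad_λ a : A ↦ {a_λ A}` on the affine Poisson vertex algebra `S(ℂ[∂] ⊗ g)`, for
`a ∈ g`. -/
noncomputable def adLambda (a : g) : Aff g →ₗ[ℂ] Polynomial (Aff g) :=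
  D.adLambdaComp k 0 a + D.adLambdaComp k 1 a

theorem adLambda_of_mem {i : ZMod 2} {a : g} (ha : a ∈ LieSuperalgebra.comp (g := g) i) :
    D.adLambda k a = D.adLambdaComp k i a := by
  have hz : ∀ j : ZMod 2, j ≠ i → D.adLambdaComp k j a = 0 := by
    intro j hj
    have h0 : D.lambdaGen k (proj j a) = 0 := by
      ext u b
      simp [lambdaGen, proj_of_ne hj ha, lambdaBase, Aff.incl]
    ext1 x
    rw [LinearMap.zero_apply]
    induction x using Aff.induction with
    | h_alg c => exact Aff.twistedDer_algebraMap _ _ _ _ c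
    | h_gen l b hb u =>
      rw [adLambdaComp, Aff.twistedDer_gen, h0, LinearMap.zero_apply]
    | h_mul x y hx hy =>
      rw [adLambdaComp, Aff.twistedDer_mul]
      rw [adLambdaComp] at hx hy
      rw [hx, hy, mul_zero, zero_mul, add_zero]
    | h_add x y hx hy => rw [map_add, hx, hy, add_zero]
  rcases zmod2_cases i with rfl | rfl
  · rw [adLambda, hz 1 one_ne_zero, add_zero]
  · rw [adLambda, hz 0 zero_ne_one, zero_add]

theorem adLambda_incl (a b : g) :
    D.adLambda k a (Aff.incl b) =
      C (Aff.incl (LieSuperalgebra.br a b)) + (k * D.form a b) • X := by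
  have h : ∀ i, D.adLambdaComp k i a (Aff.incl b) = D.lambdaBase k (proj i a) b := by
    intro i
    rw [adLambdaComp, Aff.incl, Aff.twistedDer_gen, lambdaGen_tmul, map_one, Module.End.one_apply]
  rw [adLambda, LinearMap.add_apply, h, h]
  conv_rhs => rw [← proj_add a]
  simp only [lambdaBase, LinearMap.coe_mk, AddHom.coe_mk, map_add, LinearMap.add_apply, Aff.incl,
    TensorProduct.tmul_add, mul_add, add_smul]
  abel

theorem adLambda_mul {i j : ZMod 2} {a : g} (ha : a ∈ LieSuperalgebra.comp (g := g) i)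
    {x : Aff g} (hx : x ∈ Aff.comp j) (y : Aff g) :
    D.adLambda k a (x * y) =
      superSign i j • (C x * D.adLambda k a y) + D.adLambda k a x * C y := by
  rw [D.adLambda_of_mem k ha, adLambdaComp, Aff.twistedDer_mul]
  simp only [constPoly, AlgHom.comp_apply, Polynomial.CAlgHom_apply, Aff.sigmaPow_of_mem i hx,
    ← Polynomial.smul_C, smul_mul_assoc]

theorem adLambda_deriv (a : g) (x : Aff g) :
    D.adLambda k a (Aff.deriv x) = lamPlusDeriv (D.adLambda k a x) := by
  have hl : ∀ (y : Aff g) (w : Polynomial (Aff g)),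
      lamPlusDeriv (C y * w) = C y * lamPlusDeriv w + C (Aff.deriv y) * w := by
    intro y w
    ext n
    simp only [lamPlusDeriv, LinearMap.add_apply, LinearMap.mulLeft_apply, Polynomial.coeff_add,
      coeff_coeffwise, Polynomial.coeff_C_mul, mul_add, Aff.deriv_mul]
    cases n with
    | zero => simp
    | succ n => simp [Polynomial.coeff_X_mul, add_assoc]
  have hr : ∀ (y : Aff g) (w : Polynomial (Aff g)),
      lamPlusDeriv (w * C y) = w * C (Aff.deriv y) + lamPlusDeriv w * C y := by
    intro y w
    ext n
    simp only [lamPlusDeriv, LinearMap.add_apply, LinearMap.mulLeft_apply, Polynomial.coeff_add,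
      coeff_coeffwise, Polynomial.coeff_mul_C, add_mul, Aff.deriv_mul]
    cases n with
    | zero => simp
    | succ n => simp [Polynomial.coeff_X_mul, add_left_comm]
  have hs : ∀ (i : ZMod 2) (y : Aff g), Aff.sigmaPow i (Aff.deriv y) =
      Aff.deriv (Aff.sigmaPow i y) := by
    intro i y
    rcases zmod2_cases i with rfl | rfl <;> simp [Aff.sigmaPow, Aff.sigma_deriv]
  have h : ∀ i, D.adLambdaComp k i a (Aff.deriv x) = lamPlusDeriv (D.adLambdaComp k i a x) := by
    intro i
    induction x using Aff.induction with
    | h_alg c =>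
      rw [Aff.deriv_algebraMap, map_zero, adLambdaComp, Aff.twistedDer_algebraMap, map_zero]
    | h_gen l b hb u =>
      rw [Aff.deriv_gen, adLambdaComp, Aff.twistedDer_gen, Aff.twistedDer_gen, lambdaGen_tmul,
        lambdaGen_tmul, map_mul, Polynomial.aeval_X, Module.End.mul_apply]
    | h_mul x y hx hy =>
      rw [adLambdaComp] at hx hy ⊢
      rw [Aff.deriv_mul, map_add, Aff.twistedDer_mul, Aff.twistedDer_mul, Aff.twistedDer_mul,
        map_add]
      simp only [constPoly, AlgHom.comp_apply, Polynomial.CAlgHom_apply, hl, hr, hs]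
      simp only [constPoly] at hx hy
      rw [hx, hy]
      abel
    | h_add x y hx hy => rw [map_add, map_add, map_add, map_add, hx, hy]
  rw [adLambda, LinearMap.add_apply, LinearMap.add_apply, map_add, h, h]

end Setup

end Lambda

end Affine

section Quotient

variable {g : Type*} [AddCommGroup g] [Module ℂ g] [LieSuperalgebra g]

namespace Setup

variable (D : Setup g)

/-- The elements `∂^n (m + (f|m))`, `m ∈ 𝔪`, `n ≥ 0`; the two-sided ideal that they generate is
the differential ideal `I` generated by the elements `m + (f|m)`. -/
inductive IdealRel : Aff g → Aff g → Prop
  | gen (n : ℕ) {m : g} (hm : m ∈ D.mm) :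
      IdealRel ((Aff.deriv ^ n) (Aff.incl m + algebraMap ℂ _ (D.form D.f m))) 0

/-- The differential superalgebra `V_I(𝔭) = S(ℂ[∂] ⊗ g) / I`. -/
def VI : Type _ := RingQuot D.IdealRel

noncomputable instance : Ring D.VI := inferInstanceAs (Ring (RingQuot D.IdealRel))

noncomputable instance : Algebra ℂ D.VI := inferInstanceAs (Algebra ℂ (RingQuot D.IdealRel))

/-- The quotient map `S(ℂ[∂] ⊗ g) → V_I(𝔭)`. -/
noncomputable def quo : Aff g →ₐ[ℂ] D.VI := RingQuot.mkAlgHom ℂ D.IdealRel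

theorem quo_surjective : Function.Surjective D.quo := RingQuot.mkAlgHom_surjective ℂ _

theorem quo_rel (n : ℕ) {m : g} (hm : m ∈ D.mm) :
    D.quo ((Aff.deriv ^ n) (Aff.incl m + algebraMap ℂ _ (D.form D.f m))) = 0 := by
  have := RingQuot.mkAlgHom_rel ℂ (IdealRel.gen n hm)
  rw [map_zero] at this
  exact this

theorem quo_incl {m : g} (hm : m ∈ D.mm) :
    D.quo (Aff.incl m) = -algebraMap ℂ _ (D.form D.f m) := by
  have := D.quo_rel 0 hm
  rw [pow_zero, Module.End.one_apply, map_add, AlgHom.commutes] at this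
  exact eq_neg_of_add_eq_zero_left this

section lift

variable {Q : Type*} [Ring Q] [Algebra ℂ Q] (φ : Aff g →ₐ[ℂ] Q)
  (hφ : ∀ (n : ℕ) ⦃m : g⦄, m ∈ D.mm →
    φ ((Aff.deriv ^ n) (Aff.incl m + algebraMap ℂ _ (D.form D.f m))) = 0)

/-- Algebra homomorphisms that vanish on `I` factor through `V_I(𝔭)`. -/
noncomputable def liftVI : D.VI →ₐ[ℂ] Q :=
  RingQuot.liftAlgHom ℂ ⟨φ, by
    rintro _ _ ⟨n, hm⟩
    rw [hφ n hm, map_zero]⟩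

theorem liftVI_quo (x : Aff g) : D.liftVI φ hφ (D.quo x) = φ x :=
  RingQuot.liftAlgHom_mkAlgHom_apply ℂ φ _ x

end lift

theorem derivVI_compat : Aff.IsCompat D.quo D.quo (D.quo.toLinearMap ∘ₗ Aff.gen g ∘ₗ Aff.shift) := by
  intro i j a b ha hb u v
  have := congrArg D.quo (Aff.deriv_compat ha hb u v)
  simpa using this

theorem twistedDer_quo (x : Aff g) :
    Aff.twistedDer D.quo D.quo _ D.derivVI_compat x = D.quo (Aff.deriv x) := by
  induction x using Aff.induction with
  | h_alg c => rw [Aff.twistedDer_algebraMap, Aff.deriv_algebraMap, map_zero]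
  | h_gen i a ha u => rw [Aff.twistedDer_gen, Aff.deriv_gen]; simp [Aff.shift_tmul]
  | h_mul x y hx hy => rw [Aff.twistedDer_mul, Aff.deriv_mul, hx, hy]; simp
  | h_add x y hx hy => rw [map_add, map_add, map_add, hx, hy]

theorem derivVI_lift (n : ℕ) ⦃m : g⦄ (hm : m ∈ D.mm) :
    Aff.lift _ (Aff.upper_superComm D.derivVI_compat)
      ((Aff.deriv ^ n) (Aff.incl m + algebraMap ℂ _ (D.form D.f m))) = 0 := by
  rw [Aff.lift_upper _ _ _ D.derivVI_compat, twistedDer_quo, ← Module.End.mul_apply, ← pow_succ', D.quo_rel n hm,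
    D.quo_rel (n + 1) hm]
  ext i j
  fin_cases i <;> fin_cases j <;> rfl

/-- The even derivation `∂` of `V_I(𝔭)`, induced by that of `S(ℂ[∂] ⊗ g)`. -/
noncomputable def derivVI : D.VI →ₗ[ℂ] D.VI :=
  Matrix.entryLinearMap ℂ D.VI 0 1 ∘ₗ (D.liftVI _ D.derivVI_lift).toLinearMap

theorem derivVI_quo (x : Aff g) : D.derivVI (D.quo x) = D.quo (Aff.deriv x) := by
  rw [derivVI, LinearMap.comp_apply, AlgHom.toLinearMap_apply, liftVI_quo,
    Aff.lift_upper _ _ _ D.derivVI_compat, twistedDer_quo]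
  rfl

theorem derivVI_mul (x y : D.VI) :
    D.derivVI (x * y) = x * D.derivVI y + D.derivVI x * y := by
  obtain ⟨x, rfl⟩ := D.quo_surjective x
  obtain ⟨y, rfl⟩ := D.quo_surjective y
  rw [← map_mul, derivVI_quo, derivVI_quo, derivVI_quo, Aff.deriv_mul, map_add, map_mul, map_mul]

theorem sigmaVI_lift (n : ℕ) ⦃m : g⦄ (hm : m ∈ D.mm) : (D.quo.comp Aff.sigma)
    ((Aff.deriv ^ n) (Aff.incl m + algebraMap ℂ _ (D.form D.f m))) = 0 := by
  have hc : ∀ x : Aff g, Aff.sigma ((Aff.deriv ^ n) x) = (Aff.deriv ^ n) (Aff.sigma x) := by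
    intro x
    induction n with
    | zero => rfl
    | succ n ih =>
      rw [pow_succ', Module.End.mul_apply, Aff.sigma_deriv, ih, Module.End.mul_apply]
  have h0 := D.quo_rel n (D.proj_mem_mm 0 hm)
  have h1 := D.quo_rel n (D.proj_mem_mm 1 hm)
  have hs : Aff.sigma (Aff.incl m + algebraMap ℂ _ (D.form D.f m)) =
      (Aff.incl (proj 0 m) + algebraMap ℂ _ (D.form D.f (proj 0 m))) -
      (Aff.incl (proj 1 m) + algebraMap ℂ _ (D.form D.f (proj 1 m))) := by
    conv_lhs => rw [← proj_add m]
    have e0 := Aff.sigma_gen (proj_mem 0 m) 1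
    have e1 := Aff.sigma_gen (proj_mem 1 m) 1
    rw [superSign_zero_right, one_smul] at e0
    rw [superSign_one_one, neg_smul, one_smul] at e1
    simp only [Aff.incl] at e0 e1 ⊢
    rw [map_add, AlgHom.commutes, TensorProduct.tmul_add, map_add, map_add, e0, e1, map_add,
      D.form_f_odd (proj_mem 1 m)]
    simp only [add_zero, map_zero]
    abel
  rw [AlgHom.comp_apply, hc, hs, map_sub, map_sub, h0, h1, sub_zero]

/-- The parity involution of `V_I(𝔭)`: multiplication by `(-1)^{p(F)}` on homogeneous `F`. -/
noncomputable def sigmaVI : D.VI →ₐ[ℂ] D.VI := D.liftVI _ D.sigmaVI_lift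

theorem sigmaVI_quo (x : Aff g) : D.sigmaVI (D.quo x) = D.quo (Aff.sigma x) :=
  D.liftVI_quo _ _ x

/-- The homogeneous elements of parity `i` of `V_I(𝔭)`. -/
noncomputable def compVI (i : ZMod 2) : Submodule ℂ D.VI :=
  LinearMap.ker (D.sigmaVI.toLinearMap - superSign 1 i • LinearMap.id)

theorem mem_compVI {i : ZMod 2} {x : D.VI} : x ∈ D.compVI i ↔ D.sigmaVI x = superSign 1 i • x := by
  simp [compVI, sub_eq_zero]

theorem exists_of_mem_compVI {i : ZMod 2} {x : D.VI} (hx : x ∈ D.compVI i) :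
    ∃ y ∈ Aff.comp (g := g) i, D.quo y = x := by
  obtain ⟨z, rfl⟩ := D.quo_surjective x
  rw [mem_compVI, sigmaVI_quo] at hx
  refine ⟨(1 / 2 : ℂ) • (z + superSign 1 i • Aff.sigma z), ?_, ?_⟩
  · rw [Aff.mem_comp, map_smul, map_add, map_smul, Aff.sigma_sigma, smul_comm, smul_add (superSign 1 i),
      smul_smul (superSign 1 i) (superSign 1 i), superSign_mul_self, one_smul, add_comm]
  · rw [map_smul, map_add, map_smul, hx, smul_smul, superSign_mul_self, one_smul, ← two_smul ℂ,
      smul_smul]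
    norm_num

theorem superCommVI {i j : ZMod 2} {x y : D.VI} (hx : x ∈ D.compVI i) (hy : y ∈ D.compVI j) :
    x * y = superSign i j • (y * x) := by
  obtain ⟨x', hx', ex⟩ := D.exists_of_mem_compVI hx
  obtain ⟨y', hy', ey⟩ := D.exists_of_mem_compVI hy
  rw [← ex, ← ey, ← map_mul, Aff.superComm hx' hy', map_smul, map_mul]

theorem derivVI_mem {i : ZMod 2} {x : D.VI} (hx : x ∈ D.compVI i) : D.derivVI x ∈ D.compVI i := by
  obtain ⟨x', hx', ex⟩ := D.exists_of_mem_compVI hx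
  have := Aff.mem_comp.1 (Aff.deriv_mem_comp hx')
  rw [← ex, derivVI_quo, mem_compVI, sigmaVI_quo, this, map_smul]

theorem algebraMap_mem_compVI (c : ℂ) : algebraMap ℂ D.VI c ∈ D.compVI 0 := by
  rw [mem_compVI, AlgHom.commutes, superSign_zero_right, one_smul]

/-- The classical affine W-superalgebra `W(g, f, k) = (S(ℂ[∂] ⊗ g) / I)^{ad_λ 𝔫}`, that is, the
set of classes `A + I` with `{n_λ A} ∈ I[λ]` for all `n ∈ 𝔫`. -/
noncomputable def W (k : ℂ) : Submodule ℂ D.VI :=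
  Submodule.map D.quo.toLinearMap
    { carrier := {A | ∀ n ∈ D.nn, (D.adLambda k n A).map (D.quo : Aff g →+* D.VI) = 0}
      add_mem' := by
        intro a b ha hb n hn
        rw [map_add, Polynomial.map_add, ha n hn, hb n hn, add_zero]
      zero_mem' := by
        intro n _
        rw [map_zero, Polynomial.map_zero]
      smul_mem' := by
        intro c a ha n hn
        have h : ∀ p : Polynomial (Aff g), (c • p).map (D.quo : Aff g →+* D.VI) =
            c • p.map (D.quo : Aff g →+* D.VI) := by
          intro p
          ext l
          rw [Polynomial.coeff_map, Polynomial.coeff_smul, Polynomial.coeff_smul,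
            Polynomial.coeff_map]
          exact map_smul D.quo c _
        rw [map_smul, h, ha n hn, smul_zero] }

/-- The superspace `g ⊗ V_I(𝔭)`. -/
abbrev Cur : Type _ := g ⊗[ℂ] D.VI

/-- The bracket of `g ⊗ V_I(𝔭)`,
`[a ⊗ F, b ⊗ G] = (-1)^{p(b)p(F)} [a,b] ⊗ FG`. -/
noncomputable def curBr : D.Cur →ₗ[ℂ] D.Cur →ₗ[ℂ] D.Cur :=
  TensorProduct.map₂ ((LieSuperalgebra.br (g := g)).compl₂ (proj 0)) (LinearMap.mul ℂ D.VI) +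
  TensorProduct.map₂ ((LieSuperalgebra.br (g := g)).compl₂ (proj 1))
    (LinearMap.mul ℂ D.VI ∘ₗ D.sigmaVI.toLinearMap)

theorem curBr_tmul {i j : ZMod 2} (a : g) {b : g} (hb : b ∈ LieSuperalgebra.comp (g := g) i)
    {F : D.VI} (hF : F ∈ D.compVI j) (G : D.VI) :
    D.curBr (a ⊗ₜ F) (b ⊗ₜ G) = superSign i j • (LieSuperalgebra.br a b ⊗ₜ (F * G)) := by
  have hF' := D.mem_compVI.1 hF
  rcases zmod2_cases i with rfl | rfl
  · simp [curBr, proj_self hb, proj_of_ne one_ne_zero hb, superSign_zero_left]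
  · simp [curBr, proj_self hb, proj_of_ne zero_ne_one hb, hF']

/-- The extension `∂(a ⊗ F) = a ⊗ ∂F` of the derivation to `g ⊗ V_I(𝔭)`. -/
noncomputable def curDeriv : D.Cur →ₗ[ℂ] D.Cur := LinearMap.lTensor g D.derivVI

/-- The adjoint action in `ℂ∂ ⋉ (g ⊗ V_I(𝔭))`, whose bracket is
`[c₁∂ + x, c₂∂ + y] = c₁ ∂y - c₂ ∂x + [x, y]`; the pair `(c, x)` stands for `c∂ + x`. -/
noncomputable def semiAd (Y : ℂ × D.Cur) : Module.End ℂ (ℂ × D.Cur) where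
  toFun Z := (0, Y.1 • D.curDeriv Z.2 - Z.1 • D.curDeriv Y.2 + D.curBr Y.2 Z.2)
  map_add' Z Z' := by
    simp only [Prod.fst_add, Prod.snd_add, map_add, smul_add, add_smul, Prod.mk_add_mk, add_zero]
    congr 1
    abel
  map_smul' c Z := by
    simp only [Prod.smul_fst, Prod.smul_snd, map_smul, smul_add, smul_sub, smul_eq_mul, mul_smul,
      RingHom.id_apply, Prod.smul_mk, mul_zero]
    rw [smul_comm]

/-- The even part `(U ⊗ V_I(𝔭))_0` for a graded subspace `U` of `g`. -/
noncomputable def evenPart (U : Submodule ℂ g) : Submodule ℂ D.Cur :=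
  Submodule.span ℂ {t | ∃ (i : ZMod 2) (a : g) (F : D.VI),
    a ∈ U ∧ a ∈ LieSuperalgebra.comp (g := g) i ∧ F ∈ D.compVI i ∧ t = a ⊗ₜ[ℂ] F}

/-- The phase space `(𝔪^⊥ ⊗ V_I(𝔭))_0`. -/
noncomputable def phase : Submodule ℂ D.Cur := D.evenPart D.mperp

/-- The Lax operator `k∂ + q - f ⊗ 1`. -/
noncomputable def lax (k : ℂ) (q : D.Cur) : ℂ × D.Cur := (k, q - D.f ⊗ₜ[ℂ] (1 : D.VI))

/-- `e^{ad Y} Z = Z'`: the terms of `∑ₙ (1/n!) (ad Y)^n Z` vanish from some point on and the sum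
is `Z'`. -/
def IsExpAd (Y Z Z' : ℂ × D.Cur) : Prop :=
  ∃ N : ℕ, (D.semiAd Y ^ N) Z = 0 ∧
    Z' = ∑ n ∈ Finset.range N, ((n.factorial : ℂ)⁻¹) • (D.semiAd Y ^ n) Z

/-- `q' = q^Y` for some `Y ∈ (𝔫 ⊗ V_I(𝔭))_0`, where
`e^{ad Y} (k∂ + q - f ⊗ 1) = k∂ + q^Y - f ⊗ 1`. -/
def GaugeEquiv (k : ℂ) (q q' : D.phase) : Prop :=
  ∃ Y ∈ D.evenPart D.nn, D.IsExpAd (0, Y) (D.lax k q) (D.lax k q')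

/-- The pairing `(a ⊗ F | p) = (a|p) F` of `g ⊗ V_I(𝔭)` with `p ∈ g`. -/
noncomputable def curPair (p : g) : D.Cur →ₗ[ℂ] D.VI :=
  TensorProduct.lift (LinearMap.lsmul ℂ D.VI ∘ₗ D.form.flip p)

theorem curPair_tmul (p a : g) (F : D.VI) : D.curPair p (a ⊗ₜ F) = D.form a p • F := by
  simp [curPair]

theorem curPair_mem {i : ZMod 2} {p : g} (hp : p ∈ LieSuperalgebra.comp (g := g) i)
    {q : D.Cur} {U : Submodule ℂ g} (hq : q ∈ D.evenPart U) : D.curPair p q ∈ D.compVI i := by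
  induction hq using Submodule.span_induction with
  | mem x hx =>
    obtain ⟨j, a, F, -, ha, hF, rfl⟩ := hx
    rw [curPair_tmul]
    by_cases hij : j = i
    · subst hij
      exact Submodule.smul_mem _ _ hF
    · rw [D.form_even ha hp hij, zero_smul]
      exact zero_mem _
  | zero => rw [map_zero]; exact zero_mem _
  | add x y _ _ hx hy => rw [map_add]; exact add_mem hx hy
  | smul c x _ hx => rw [map_smul]; exact Submodule.smul_mem _ c hx

theorem curPair_phase {m : g} (hm : m ∈ D.mm) {q : D.Cur} (hq : q ∈ D.phase) :
    D.curPair m q = 0 := by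
  induction hq using Submodule.span_induction with
  | mem x hx =>
    obtain ⟨j, a, F, ha, -, -, rfl⟩ := hx
    rw [curPair_tmul, ha m hm, zero_smul]
  | zero => rw [map_zero]
  | add x y _ _ hx hy => rw [map_add, hx, hy, add_zero]
  | smul c x _ hx => rw [map_smul, hx, smul_zero]

/-- `p ↦ p(c∂ + x)` for `p ∈ g`, where `p(∂) = 0` and `p(a ⊗ F) = (a|p) F`. -/
noncomputable def evalBase (L : ℂ × D.Cur) : g →ₗ[ℂ] D.VI where
  toFun p := D.curPair p L.2
  map_add' p p' := by
    have : D.curPair (p + p') = D.curPair p + D.curPair p' := by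
      ext a F
      simp [curPair_tmul, add_smul]
    rw [this, LinearMap.add_apply]
  map_smul' c p := by
    have : D.curPair (c • p) = c • D.curPair p := by
      ext a F
      simp [curPair_tmul, mul_smul]
    rw [this, LinearMap.smul_apply, RingHom.id_apply]

/-- `u(∂)p ↦ u(∂)(p(L))` for `p ∈ g`. -/
noncomputable def evalGen (L : ℂ × D.Cur) : Gens g →ₗ[ℂ] D.VI :=
  TensorProduct.lift ((Polynomial.aeval (D.derivVI : Module.End ℂ D.VI)).toLinearMap.compl₂
    (D.evalBase L))

theorem evalGen_tmul (L : ℂ × D.Cur) (u : Polynomial ℂ) (p : g) :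
    D.evalGen L (u ⊗ₜ p) =
      Polynomial.aeval (D.derivVI : Module.End ℂ D.VI) u (D.curPair p L.2) := by
  simp [evalGen, evalBase]

theorem aeval_derivVI_mem {i : ZMod 2} {w : D.VI} (hw : w ∈ D.compVI i) (u : Polynomial ℂ) :
    Polynomial.aeval (D.derivVI : Module.End ℂ D.VI) u w ∈ D.compVI i := by
  induction u using Polynomial.induction_on with
  | C c =>
    rw [Polynomial.aeval_C, Module.algebraMap_end_apply]
    exact Submodule.smul_mem _ c hw
  | add p q hp hq => rw [map_add, LinearMap.add_apply]; exact add_mem hp hq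
  | monomial n c h =>
    rw [pow_succ', mul_left_comm, map_mul, Polynomial.aeval_X, Module.End.mul_apply]
    exact D.derivVI_mem h

theorem evalGen_superComm (k : ℂ) (q : D.phase) : Aff.IsSuperComm (D.evalGen (D.lax k q)) := by
  have hmem : ∀ {i : ZMod 2} {a : g}, a ∈ LieSuperalgebra.comp (g := g) i →
      ∀ u : Polynomial ℂ, D.evalGen (D.lax k q) (u ⊗ₜ a) ∈ D.compVI i := by
    intro i a ha u
    rw [evalGen_tmul]
    refine D.aeval_derivVI_mem ?_ u
    rw [lax, map_sub]
    refine sub_mem (D.curPair_mem ha q.2) (D.curPair_mem (U := ⊤) ha (Submodule.subset_span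
      ⟨0, D.f, 1, trivial, D.f_even, ?_, rfl⟩))
    have := D.algebraMap_mem_compVI 1
    rwa [map_one] at this
  intro i j a b ha hb u v
  exact D.superCommVI (hmem ha u) (hmem hb v)

theorem lift_evalGen_deriv (k : ℂ) (q : D.phase) (x : Aff g) :
    Aff.lift _ (D.evalGen_superComm k q) (Aff.deriv x) =
      D.derivVI (Aff.lift _ (D.evalGen_superComm k q) x) := by
  have h0 : ∀ c : ℂ, D.derivVI (algebraMap ℂ _ c) = 0 := by
    intro c
    rw [← AlgHom.commutes D.quo, derivVI_quo, Aff.deriv_algebraMap, map_zero]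
  induction x using Aff.induction with
  | h_alg c => rw [Aff.deriv_algebraMap, map_zero, AlgHom.commutes, h0]
  | h_gen i a ha u =>
    rw [Aff.deriv_gen, Aff.lift_gen, Aff.lift_gen, evalGen_tmul, evalGen_tmul, map_mul,
      Polynomial.aeval_X, Module.End.mul_apply]
  | h_mul x y hx hy =>
    rw [Aff.deriv_mul, map_add, map_mul, map_mul, hx, hy, map_mul, derivVI_mul]
  | h_add x y hx hy => rw [map_add, map_add, map_add, map_add, hx, hy]

theorem eval_lift (k : ℂ) (q : D.phase) (n : ℕ) ⦃m : g⦄ (hm : m ∈ D.mm) :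
    Aff.lift _ (D.evalGen_superComm k q)
      ((Aff.deriv ^ n) (Aff.incl m + algebraMap ℂ _ (D.form D.f m))) = 0 := by
  induction n with
  | zero =>
    rw [pow_zero, Module.End.one_apply, map_add, AlgHom.commutes, Aff.incl, Aff.lift_gen,
      evalGen_tmul, map_one, Module.End.one_apply, lax, map_sub, D.curPair_phase hm q.2,
      curPair_tmul, Algebra.algebraMap_eq_smul_one]
    simp
  | succ n ih =>
    rw [pow_succ', Module.End.mul_apply, lift_evalGen_deriv, ih, map_zero]

/-- The value `P(q) = P(k∂ + q - f ⊗ 1)` of `P ∈ V_I(𝔭)` at `q` in the phase space, as the algebra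
homomorphism `P ↦ P(q)`. It commutes with `∂` and is given on `p ∈ 𝔭` by
`p(a ⊗ F) = (a|p) F`, see `eval_deriv` and `eval_pp`; since `V_I(𝔭)` is generated by `𝔭` as a
differential algebra, this determines it, see `eval_unique`. -/
noncomputable def eval (k : ℂ) (q : D.phase) : D.VI →ₐ[ℂ] D.VI :=
  D.liftVI _ (D.eval_lift k q)

theorem eval_deriv (k : ℂ) (q : D.phase) (P : D.VI) :
    D.eval k q (D.derivVI P) = D.derivVI (D.eval k q P) := by
  obtain ⟨x, rfl⟩ := D.quo_surjective P
  rw [derivVI_quo, eval, liftVI_quo, liftVI_quo, lift_evalGen_deriv]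

theorem eval_pp (k : ℂ) (q : D.phase) {p : g} (hp : p ∈ D.pp) :
    D.eval k q (D.quo (Aff.incl p)) = D.curPair p q := by
  rw [eval, liftVI_quo, Aff.incl, Aff.lift_gen, evalGen_tmul, map_one, Module.End.one_apply, lax,
    map_sub, curPair_tmul, D.form_f_pp hp, zero_smul, sub_zero]

theorem eval_unique (hg : D.mm ⊔ D.pp = ⊤) (k : ℂ) (q : D.phase) (φ : D.VI →ₐ[ℂ] D.VI)
    (hd : ∀ P, φ (D.derivVI P) = D.derivVI (φ P))
    (hp : ∀ p ∈ D.pp, φ (D.quo (Aff.incl p)) = D.curPair p q) : φ = D.eval k q := by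
  have h1 : ∀ a : g, φ (D.quo (Aff.incl a)) = D.eval k q (D.quo (Aff.incl a)) := by
    intro a
    obtain ⟨m, hm, p, hp', rfl⟩ := Submodule.mem_sup.1 (hg ▸ Submodule.mem_top : a ∈ D.mm ⊔ D.pp)
    have e : Aff.incl (m + p) = Aff.incl m + Aff.incl p := by
      simp only [Aff.incl, TensorProduct.tmul_add, map_add]
    rw [e, map_add, map_add, map_add, hp p hp', eval_pp D k q hp', D.quo_incl hm, map_neg, map_neg,
      AlgHom.commutes, AlgHom.commutes]
  have h2 : ∀ x : Aff g, φ (D.quo x) = D.eval k q (D.quo x) := by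
    refine Aff.hom_ext (φ := φ.comp D.quo) (ψ := (D.eval k q).comp D.quo) ?_
    intro u a
    simp only [AlgHom.comp_apply]
    induction u using Polynomial.induction_on with
    | C c =>
      have : (C c : Polynomial ℂ) ⊗ₜ[ℂ] a = c • ((1 : Polynomial ℂ) ⊗ₜ[ℂ] a) := by
        rw [TensorProduct.smul_tmul', Polynomial.smul_eq_C_mul, mul_one]
      rw [this, map_smul, map_smul, map_smul, map_smul]
      exact congrArg (c • ·) (h1 a)
    | add p p' h h' => rw [TensorProduct.add_tmul, map_add, map_add, map_add, map_add, h, h']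
    | monomial n c h =>
      rw [pow_succ', mul_left_comm, ← Aff.deriv_gen, ← derivVI_quo, hd, h, eval_deriv]
  ext P
  obtain ⟨x, rfl⟩ := D.quo_surjective P
  exact h2 x

/-- The subalgebra of gauge invariant functions: those `P ∈ V_I(𝔭)` with `P(q) = P(q')` for all
gauge equivalent `q, q'` in the phase space. -/
noncomputable def gaugeInvariants (k : ℂ) : Subalgebra ℂ D.VI where
  carrier := {P | ∀ q q' : D.phase, D.GaugeEquiv k q q' → D.eval k q P = D.eval k q' P}
  mul_mem' := by
    intro a b ha hb q q' h
    rw [map_mul, map_mul, ha q q' h, hb q q' h]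
  add_mem' := by
    intro a b ha hb q q' h
    rw [map_add, map_add, ha q q' h, hb q q' h]
  algebraMap_mem' := by
    intro c q q' _
    rw [AlgHom.commutes, AlgHom.commutes]

end Setup

end Quotient

end DrinfeldSokolov

/-! ### Maps out of `S(ℂ[∂] ⊗ g)` that intertwine `∂` are controlled by `g` -/

namespace DrinfeldSokolov

open Polynomial (X C)

/-! The bracket `{n_λ ·}` with `n ∈ 𝔫` is the infinitesimal gauge action. Let `L = k∂ + q - f ⊗ 1`,
let `Y` be even in `𝔫 ⊗ V_I(𝔭)` with the exponential series of `ad Y` finite on `L`, and evaluate `A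
∈ S(ℂ[∂] ⊗ g)` along the curve `e^{t ad Y} L`. This gives a homomorphism `pathHom` to `V_I(𝔭)[t]`
that commutes with `∂`. Its `t`-derivative is a derivation along it, commuting with `∂`, so it is
determined on `g`. For `Y = n ⊗ F` invariance of the form identifies it there: if `{n_λ A} = ∑ cᵢ
λⁱ`, then the derivative of `A` along the curve is `-∑ (∂ⁱF) cᵢ`, with `cᵢ` evaluated on the curve
(`isGaugeDerivation_tmul`, `derivative_pathHom`).

If all `{n_λ A}` lie in `I[λ]`, then, as the curve stays over the phase space and `pathHom`
therefore kills `I`, the derivative vanishes. So `A` takes the same value at `t = 0` and `t = 1`,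
which is gauge invariance (`W_le_gaugeInvariants`).

Conversely, let the class of `A` be gauge invariant. The phase space has a generic point, built from
dual bases of `g`, at which each `P` takes the value `P` (`eval_genericPoint`). For an eigenvector
`n` of `ad h` in `𝔫` and `F` of the same parity, `ad (n ⊗ F)` is nilpotent, so it generates a
one-parameter family of gauge transformations, and a polynomial in `t` constant at all complex
numbers is constant. Its derivative at `t = 0`, at the generic point, gives `∑ (∂ⁱF) cᵢ = 0` in
`V_I(𝔭)` for every such `F`. Taking for `F` a very high derivative of an element `a` with `(n|a) =
1`, and differentiating with respect to a single high derivative of `a`, isolates each `cᵢ`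
(`quo_eq_zero_of_sum_eq_zero`), whence `cᵢ ∈ I`. -/

theorem Aff.gen_eq_aeval_deriv {g : Type*} [AddCommGroup g] [Module ℂ g] [LieSuperalgebra g]
    (u : Polynomial ℂ) (a : g) :
    Aff.gen g (u ⊗ₜ a) = Polynomial.aeval (Aff.deriv : Module.End ℂ (Aff g)) u (Aff.incl a) := by
  induction u using Polynomial.induction_on with
  | C c =>
    rw [Polynomial.aeval_C, Module.algebraMap_end_apply, Aff.incl, ← map_smul,
      TensorProduct.smul_tmul', Polynomial.smul_eq_C_mul, mul_one]
  | add p q hp hq => rw [TensorProduct.add_tmul, map_add, map_add, LinearMap.add_apply, hp, hq]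
  | monomial n c h =>
    rw [pow_succ', mul_left_comm, ← Aff.deriv_gen, h, map_mul _ X, Polynomial.aeval_X,
      Module.End.mul_apply]

/-- Two linear maps intertwining `∂` with the same operator agree on `ℂ[∂] ⊗ g` if they do
on `g`. -/
theorem Aff.eq_gen_of_eq_incl {g : Type*} [AddCommGroup g] [Module ℂ g] [LieSuperalgebra g]
    {Q : Type*} [AddCommGroup Q] [Module ℂ Q] {φ ψ : Aff g →ₗ[ℂ] Q} {δ : Q →ₗ[ℂ] Q}
    (hφ : ∀ x, φ (Aff.deriv x) = δ (φ x)) (hψ : ∀ x, ψ (Aff.deriv x) = δ (ψ x))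
    {a : g} (h : φ (Aff.incl a) = ψ (Aff.incl a)) (u : Polynomial ℂ) :
    φ (Aff.gen g (u ⊗ₜ a)) = ψ (Aff.gen g (u ⊗ₜ a)) := by
  induction u using Polynomial.induction_on with
  | C c =>
    rw [Aff.gen_eq_aeval_deriv, Polynomial.aeval_C, Module.algebraMap_end_apply, map_smul,
      map_smul, h]
  | add p q hp hq => rw [TensorProduct.add_tmul, map_add, map_add, map_add, hp, hq]
  | monomial n c h =>
    rw [pow_succ', mul_left_comm, ← Aff.deriv_gen, hφ, hψ, h]

theorem Aff.hom_ext_incl {g : Type*} [AddCommGroup g] [Module ℂ g] [LieSuperalgebra g]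
    {Q : Type*} [Ring Q] [Algebra ℂ Q] {φ ψ : Aff g →ₐ[ℂ] Q} {δ : Q →ₗ[ℂ] Q}
    (hφ : ∀ x, φ (Aff.deriv x) = δ (φ x)) (hψ : ∀ x, ψ (Aff.deriv x) = δ (ψ x))
    (h : ∀ a : g, φ (Aff.incl a) = ψ (Aff.incl a)) (x : Aff g) : φ x = ψ x :=
  Aff.hom_ext (fun u a => Aff.eq_gen_of_eq_incl (φ := φ.toLinearMap) (ψ := ψ.toLinearMap)
    hφ hψ (h a) u) x

/-! ### Polynomials in `t` over a noncommutative `ℂ`-algebra -/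

section Coeffwise

variable {A B : Type*} [Ring A] [Algebra ℂ A] [Ring B] [Algebra ℂ B]

theorem coeffwise_monomial (T : A →ₗ[ℂ] B) (n : ℕ) (a : A) :
    coeffwise T (Polynomial.monomial n a) = Polynomial.monomial n (T a) := by
  ext m
  rw [coeff_coeffwise, Polynomial.coeff_monomial, Polynomial.coeff_monomial]
  split_ifs <;> simp

theorem coeffwise_C (T : A →ₗ[ℂ] B) (a : A) : coeffwise T (C a) = C (T a) :=
  coeffwise_monomial T 0 a

theorem coeffwise_mul {T : A →ₗ[ℂ] A} (hT : ∀ x y, T (x * y) = x * T y + T x * y)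
    (p q : Polynomial A) : coeffwise T (p * q) = p * coeffwise T q + coeffwise T p * q := by
  ext n
  simp only [coeff_coeffwise, Polynomial.coeff_add, Polynomial.coeff_mul, map_sum, hT,
    Finset.sum_add_distrib]

theorem coeffwise_derivative (T : A →ₗ[ℂ] A) (p : Polynomial A) :
    coeffwise T (Polynomial.derivative p) = Polynomial.derivative (coeffwise T p) := by
  ext n
  -- The factor `n + 1` produced by differentiation is a complex scalar, so a linear `T` passes
  -- through it.
  have h : ∀ (x : A), T (x * ((n : A) + 1)) = T x * ((n : A) + 1) := by
    intro x
    have := T.map_smul ((n : ℂ) + 1) x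
    rw [Algebra.smul_def, Algebra.smul_def] at this
    simp only [map_add, map_natCast, map_one] at this
    have e : ∀ y : A, y * ((n : A) + 1) = ((n : A) + 1) * y := fun y => by
      rw [mul_add, add_mul, mul_one, one_mul, Nat.cast_comm]
    rw [e, e, this]
  rw [coeff_coeffwise, Polynomial.coeff_derivative, Polynomial.coeff_derivative, coeff_coeffwise, h]

theorem eq_C_of_derivative_eq_zero {p : Polynomial A} (h : Polynomial.derivative p = 0) :
    p = C (p.coeff 0) := by
  ext n
  cases n with
  | zero => simp
  | succ n =>
    have := congrArg (fun q => q.coeff n) h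
    simp only [Polynomial.coeff_derivative, Polynomial.coeff_zero] at this
    have e : ((n : ℂ) + 1) • p.coeff (n + 1) = 0 := by
      rw [Algebra.smul_def, Algebra.commutes]
      simpa using this
    rw [Polynomial.coeff_C_succ]
    exact (smul_eq_zero.1 e).resolve_left (by exact_mod_cast n.succ_ne_zero)

/-- Evaluation of polynomials with coefficients in a `ℂ`-algebra at a complex number. -/
noncomputable def evalAt (A : Type*) [Ring A] [Algebra ℂ A] (c : ℂ) : Polynomial A →ₐ[ℂ] A :=
  Polynomial.eval₂AlgHom (AlgHom.id ℂ A) (algebraMap ℂ A c)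
    fun a => (Algebra.commutes c a).symm

theorem evalAt_monomial (c : ℂ) (n : ℕ) (a : A) :
    evalAt A c (Polynomial.monomial n a) = c ^ n • a := by
  have : evalAt A c (Polynomial.monomial n a) = a * algebraMap ℂ A c ^ n :=
    Polynomial.eval₂_monomial _ _
  rw [this, ← map_pow, ← Algebra.commutes, Algebra.smul_def]

theorem evalAt_C (c : ℂ) (a : A) : evalAt A c (C a) = a := by
  rw [← Polynomial.monomial_zero_left, evalAt_monomial, pow_zero, one_smul]

theorem evalAt_coeffwise (c : ℂ) (T : A →ₗ[ℂ] A) (p : Polynomial A) :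
    evalAt A c (coeffwise T p) = T (evalAt A c p) := by
  induction p using Polynomial.induction_on' with
  | add p q hp hq => simp only [map_add, hp, hq]
  | monomial n a => rw [coeffwise_monomial, evalAt_monomial, evalAt_monomial, map_smul]

/-- Linear functionals separate the coefficients, and applying one coefficientwise reduces the claim
to complex polynomials, where vanishing at every point suffices. This turns gauge invariance under
all `e^{c ad Y}` into an identity of polynomials. -/
theorem eq_zero_of_evalAt_eq_zero {p : Polynomial A} (h : ∀ c, evalAt A c p = 0) : p = 0 := by
  ext n
  rw [Polynomial.coeff_zero, ← Module.forall_dual_apply_eq_zero_iff ℂ]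
  intro l
  have key : ∀ (p : Polynomial A) (c : ℂ), (coeffwise l p).eval c = l (evalAt A c p) := by
    intro p c
    induction p using Polynomial.induction_on' with
    | add p q hp hq => rw [map_add, Polynomial.eval_add, hp, hq, map_add, map_add]
    | monomial n a =>
      rw [coeffwise_monomial, evalAt_monomial, map_smul, Polynomial.eval_monomial, smul_eq_mul,
        mul_comm]
  have hz : coeffwise l p = 0 := Polynomial.funext fun c => by rw [key, h, map_zero,
    Polynomial.eval_zero]
  rw [← coeff_coeffwise, hz, Polynomial.coeff_zero]

end Coeffwise

variable {g : Type*} [AddCommGroup g] [Module ℂ g] [LieSuperalgebra g]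

/-! ### Parities and brackets in `g ⊗ V_I(𝔭)` -/

namespace Setup

variable (D : Setup g)

theorem mul_mem_compVI {i j : ZMod 2} {x y : D.VI} (hx : x ∈ D.compVI i) (hy : y ∈ D.compVI j) :
    x * y ∈ D.compVI (i + j) := by
  rw [mem_compVI] at hx hy ⊢
  rw [map_mul, hx, hy, smul_mul_smul_comm, superSign_comm 1 (i + j), superSign_add,
    superSign_comm i, superSign_comm j]

theorem quo_mem_compVI {i : ZMod 2} {x : Aff g} (hx : x ∈ Aff.comp i) : D.quo x ∈ D.compVI i := by
  rw [mem_compVI, sigmaVI_quo, Aff.mem_comp.1 hx, map_smul]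

theorem quo_gen_mem_compVI {i : ZMod 2} {a : g} (ha : a ∈ LieSuperalgebra.comp (g := g) i)
    (u : Polynomial ℂ) : D.quo (Aff.gen g (u ⊗ₜ a)) ∈ D.compVI i :=
  D.quo_mem_compVI (Aff.gen_mem_comp ha u)

theorem derivVI_pow_mem {i : ZMod 2} {x : D.VI} (hx : x ∈ D.compVI i) (n : ℕ) :
    (D.derivVI ^ n) x ∈ D.compVI i := by
  induction n with
  | zero => exact hx
  | succ n ih => rw [pow_succ', Module.End.mul_apply]; exact D.derivVI_mem ih

theorem derivVI_pow_quo (n : ℕ) (x : Aff g) :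
    (D.derivVI ^ n) (D.quo x) = D.quo ((Aff.deriv ^ n) x) := by
  induction n with
  | zero => rfl
  | succ n ih => rw [pow_succ', Module.End.mul_apply, ih, derivVI_quo, pow_succ',
      Module.End.mul_apply]

theorem derivVI_algebraMap (c : ℂ) : D.derivVI (algebraMap ℂ _ c) = 0 := by
  rw [← AlgHom.commutes D.quo, derivVI_quo, Aff.deriv_algebraMap, map_zero]

/-- The polynomials over `V_I(𝔭)` all of whose coefficients have parity `i`. -/
noncomputable def polyCompVI (i : ZMod 2) : Submodule ℂ (Polynomial D.VI) where
  carrier := {w | ∀ n, w.coeff n ∈ D.compVI i}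
  add_mem' := by
    intro a b ha hb n
    rw [Polynomial.coeff_add]
    exact add_mem (ha n) (hb n)
  zero_mem' := by
    intro n
    rw [Polynomial.coeff_zero]
    exact zero_mem _
  smul_mem' := by
    intro c a ha n
    rw [Polynomial.coeff_smul]
    exact Submodule.smul_mem _ c (ha n)

theorem monomial_mem_polyCompVI {i : ZMod 2} {x : D.VI} (hx : x ∈ D.compVI i) (n : ℕ) :
    Polynomial.monomial n x ∈ D.polyCompVI i := by
  intro m
  rw [Polynomial.coeff_monomial]
  split_ifs
  · exact hx
  · exact zero_mem _

theorem aeval_coeffwise_mem {i : ZMod 2} {w : Polynomial D.VI} (hw : w ∈ D.polyCompVI i)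
    (u : Polynomial ℂ) :
    Polynomial.aeval (coeffwise D.derivVI : Module.End ℂ (Polynomial D.VI)) u w ∈
      D.polyCompVI i := by
  induction u using Polynomial.induction_on with
  | C c =>
    rw [Polynomial.aeval_C, Module.algebraMap_end_apply]
    exact Submodule.smul_mem _ c hw
  | add p q hp hq => rw [map_add, LinearMap.add_apply]; exact add_mem hp hq
  | monomial n c h =>
    rw [pow_succ', mul_left_comm, map_mul, Polynomial.aeval_X, Module.End.mul_apply]
    intro m
    rw [coeff_coeffwise]
    exact D.derivVI_mem (h m)

theorem polyCompVI_superComm {i j : ZMod 2} {v w : Polynomial D.VI} (hv : v ∈ D.polyCompVI i)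
    (hw : w ∈ D.polyCompVI j) : v * w = superSign i j • (w * v) := by
  ext n
  rw [Polynomial.coeff_smul, Polynomial.coeff_mul, Polynomial.coeff_mul, Finset.smul_sum,
    ← Finset.Nat.sum_antidiagonal_swap]
  exact Finset.sum_congr rfl fun p _ => D.superCommVI (hv p.2) (hw p.1)

theorem evenPart_mono {U U' : Submodule ℂ g} (h : U ≤ U') : D.evenPart U ≤ D.evenPart U' := by
  refine Submodule.span_mono ?_
  rintro _ ⟨i, a, F, haU, ha, hF, rfl⟩
  exact ⟨i, a, F, h haU, ha, hF, rfl⟩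

theorem tmul_mem_evenPart {U : Submodule ℂ g} {i : ZMod 2} {a : g} {F : D.VI} (haU : a ∈ U)
    (ha : a ∈ LieSuperalgebra.comp i) (hF : F ∈ D.compVI i) : a ⊗ₜ F ∈ D.evenPart U :=
  Submodule.subset_span ⟨i, a, F, haU, ha, hF, rfl⟩

theorem tmul_one_mem_evenPart : D.f ⊗ₜ[ℂ] (1 : D.VI) ∈ D.evenPart ⊤ := by
  refine D.tmul_mem_evenPart trivial D.f_even ?_
  simpa using D.algebraMap_mem_compVI 1

theorem curDeriv_mem {U : Submodule ℂ g} {x : D.Cur} (hx : x ∈ D.evenPart U) :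
    D.curDeriv x ∈ D.evenPart U := by
  induction hx using Submodule.span_induction with
  | mem x hx =>
    obtain ⟨i, a, F, haU, ha, hF, rfl⟩ := hx
    exact D.tmul_mem_evenPart haU ha (D.derivVI_mem hF)
  | zero => rw [map_zero]; exact zero_mem _
  | add x y _ _ hx hy => rw [map_add]; exact add_mem hx hy
  | smul c x _ hx => rw [map_smul]; exact Submodule.smul_mem _ c hx

theorem curBr_mem {x y : D.Cur} (hx : x ∈ D.evenPart ⊤) (hy : y ∈ D.evenPart ⊤) :
    D.curBr x y ∈ D.evenPart ⊤ := by
  induction hx using Submodule.span_induction with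
  | mem x hx =>
    obtain ⟨i, a, F, -, ha, hF, rfl⟩ := hx
    induction hy using Submodule.span_induction with
    | mem y hy =>
      obtain ⟨j, b, G, -, hb, hG, rfl⟩ := hy
      rw [D.curBr_tmul a hb hF]
      exact Submodule.smul_mem _ _ (D.tmul_mem_evenPart trivial (LieSuperalgebra.br_mem ha hb)
        (D.mul_mem_compVI hF hG))
    | zero => rw [map_zero]; exact zero_mem _
    | add x y _ _ hx hy => rw [map_add]; exact add_mem hx hy
    | smul c x _ hx => rw [map_smul]; exact Submodule.smul_mem _ c hx
  | zero => rw [map_zero]; exact zero_mem _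
  | add x y _ _ hx hy => rw [map_add]; exact add_mem hx hy
  | smul c x _ hx => rw [map_smul]; exact Submodule.smul_mem _ c hx

theorem semiAd_snd_mem {Y : D.Cur} (hY : Y ∈ D.evenPart ⊤) {Z : ℂ × D.Cur}
    (hZ : Z.2 ∈ D.evenPart ⊤) : (D.semiAd (0, Y) Z).2 ∈ D.evenPart ⊤ := by
  simp only [semiAd, LinearMap.coe_mk, AddHom.coe_mk, zero_smul, zero_sub]
  exact add_mem (neg_mem (Submodule.smul_mem _ _ (D.curDeriv_mem hY))) (D.curBr_mem hY hZ)

theorem semiAd_pow_snd_mem {Y : D.Cur} (hY : Y ∈ D.evenPart ⊤) {Z : ℂ × D.Cur}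
    (hZ : Z.2 ∈ D.evenPart ⊤) (n : ℕ) : ((D.semiAd (0, Y) ^ n) Z).2 ∈ D.evenPart ⊤ := by
  induction n with
  | zero => exact hZ
  | succ n ih => rw [pow_succ', Module.End.mul_apply]; exact D.semiAd_snd_mem hY ih

theorem lax_snd_mem (k : ℂ) {q : D.Cur} (hq : q ∈ D.evenPart ⊤) :
    (D.lax k q).2 ∈ D.evenPart ⊤ := sub_mem hq D.tmul_one_mem_evenPart

/-- The pairing of `[n ⊗ F, c∂ + x]` with `a ∈ g`. -/
theorem curPair_semiAd_tmul {i : ZMod 2} {n : g} (hn : n ∈ LieSuperalgebra.comp i)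
    {F : D.VI} (hF : F ∈ D.compVI i) {Z : ℂ × D.Cur} (hZ : Z.2 ∈ D.evenPart ⊤) (a : g) :
    D.curPair a (D.semiAd (0, n ⊗ₜ F) Z).2 =
      -(F * D.curPair (LieSuperalgebra.br n a) Z.2 + (Z.1 * D.form n a) • D.derivVI F) := by
  have hd : D.curPair a (D.curDeriv (n ⊗ₜ F)) = D.form n a • D.derivVI F := by
    rw [curDeriv, LinearMap.lTensor_tmul, curPair_tmul]
  obtain ⟨c, z⟩ := Z
  replace hZ : z ∈ D.evenPart ⊤ := hZ
  have hb : D.curPair a (D.curBr (n ⊗ₜ F) z) =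
      -(F * D.curPair (LieSuperalgebra.br n a) z) := by
    induction hZ using Submodule.span_induction with
    | mem x hx =>
      obtain ⟨j, b, G, -, hb, hG, rfl⟩ := hx
      -- Moving `n` to the other argument by skewness and invariance costs the same sign as the one
      -- in the bracket of `g ⊗ V_I(𝔭)`, since `F` has the parity of `n`; the two signs cancel.
      have e : D.form (LieSuperalgebra.br n b) a =
          -(superSign i j * D.form b (LieSuperalgebra.br n a)) := by
        rw [LieSuperalgebra.br_skew hn hb, map_neg, map_smul, LinearMap.neg_apply,
          LinearMap.smul_apply, D.form_invariant, smul_eq_mul]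
      rw [D.curBr_tmul n hb hF, map_smul, curPair_tmul, curPair_tmul, e, smul_smul, mul_neg,
        ← mul_assoc, superSign_comm j i, superSign_mul_self, one_mul, neg_smul, mul_smul_comm]
    | zero => simp
    | add x y _ _ hx hy => rw [map_add, map_add, map_add, hx, hy, mul_add]; abel
    | smul c x _ hx => rw [map_smul, map_smul, map_smul, hx, mul_smul_comm, smul_neg]
  simp only [semiAd, LinearMap.coe_mk, AddHom.coe_mk, zero_smul, zero_sub, map_add, map_neg,
    map_smul, hd, hb, smul_smul]
  abel

theorem semiAd_add (Y Y' : D.Cur) (Z : ℂ × D.Cur) :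
    D.semiAd (0, Y + Y') Z = D.semiAd (0, Y) Z + D.semiAd (0, Y') Z := by
  simp only [semiAd, LinearMap.coe_mk, AddHom.coe_mk, map_add, LinearMap.add_apply, smul_add,
    zero_smul, zero_sub, Prod.mk_add_mk, add_zero]
  congr 1
  abel

theorem semiAd_smul (c : ℂ) (Y : D.Cur) : D.semiAd (0, c • Y) = c • D.semiAd (0, Y) := by
  refine LinearMap.ext fun Z => ?_
  simp [semiAd, smul_smul, mul_comm]

theorem semiAd_zero : D.semiAd (0, 0) = 0 := by
  simpa using D.semiAd_smul 0 0

theorem semiAd_pow_succ_fst (Y : ℂ × D.Cur) (Z : ℂ × D.Cur) (n : ℕ) :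
    ((D.semiAd Y ^ (n + 1)) Z).1 = 0 := by
  rw [pow_succ', Module.End.mul_apply]
  rfl

/-! ### The grading by `ad (h/2)` -/

section Grading

theorem mem_gr {i : ℚ} {a : g} : a ∈ D.gr i ↔ LieSuperalgebra.br D.h a = (2 * (i : ℂ)) • a := by
  rw [gr, Module.End.mem_eigenspace_iff, LinearMap.smul_apply]
  constructor
  · intro h
    rw [mul_smul, ← h, smul_smul]
    norm_num
  · intro h
    rw [h, smul_smul]
    congr 1
    ring

theorem br_h_br (a b : g) : LieSuperalgebra.br D.h (LieSuperalgebra.br a b) =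
    LieSuperalgebra.br (LieSuperalgebra.br D.h a) b +
      LieSuperalgebra.br a (LieSuperalgebra.br D.h b) := by
  have key : ∀ i : ZMod 2, LieSuperalgebra.br D.h (LieSuperalgebra.br (proj i a) b) =
      LieSuperalgebra.br (LieSuperalgebra.br D.h (proj i a)) b +
        LieSuperalgebra.br (proj i a) (LieSuperalgebra.br D.h b) := by
    intro i
    rw [LieSuperalgebra.br_jacobi D.h_even (proj_mem i a), superSign_zero_left, one_smul]
  rw [← proj_add a]
  simp only [map_add, LinearMap.add_apply, key]
  abel

theorem br_mem_gr {i j : ℚ} {a b : g} (ha : a ∈ D.gr i) (hb : b ∈ D.gr j) :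
    LieSuperalgebra.br a b ∈ D.gr (i + j) := by
  rw [mem_gr] at ha hb ⊢
  rw [br_h_br, ha, hb, map_smul, LinearMap.smul_apply, map_smul, ← add_smul]
  push_cast
  congr 1
  ring

/-- Invariance makes `ad h` skew for the form, so eigenvalues that do not cancel force
orthogonality. -/
theorem form_gr_eq_zero {i j : ℚ} (hij : i + j ≠ 0) {a b : g} (ha : a ∈ D.gr i)
    (hb : b ∈ D.gr j) : D.form a b = 0 := by
  have h1 : D.form (LieSuperalgebra.br D.h a) b = -D.form a (LieSuperalgebra.br D.h b) := by
    have : LieSuperalgebra.br D.h a = -LieSuperalgebra.br a D.h := by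
      rw [← proj_add a]
      simp only [map_add, LinearMap.add_apply,
        LieSuperalgebra.br_skew D.h_even (proj_mem _ a), superSign_zero_left, one_smul]
      abel
    rw [this, map_neg, LinearMap.neg_apply, D.form_invariant]
  rw [D.mem_gr.1 ha, D.mem_gr.1 hb, map_smul, LinearMap.smul_apply, map_smul, smul_eq_mul,
    smul_eq_mul] at h1
  have h2 : ((i + j : ℚ) : ℂ) * D.form a b = 0 := by
    push_cast
    linear_combination h1 / 2
  exact (mul_eq_zero.1 h2).resolve_left (by exact_mod_cast hij)

theorem f_mem_gr : D.f ∈ D.gr (-1) := by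
  rw [mem_gr, D.br_h_f]
  norm_num

theorem gr_le_nn {i : ℚ} (hi : 0 < i) : D.gr i ≤ D.nn :=
  le_iSup (fun i : {i : ℚ // 0 < i} => D.gr i) ⟨i, hi⟩

theorem gr_le_mm {i : ℚ} (hi : 1 ≤ i) : D.gr i ≤ D.mm :=
  le_iSup (fun i : {i : ℚ // 1 ≤ i} => D.gr i) ⟨i, hi⟩

/-- Biadditive induction principle that reduces statements on `𝔫 × 𝔪` to pairs of eigenvectors of
degrees `i > 0` and `j ≥ 1`. -/
theorem nn_mm {P : g → g → Prop} (h : ∀ i j, 0 < i → 1 ≤ j → ∀ a ∈ D.gr i, ∀ b ∈ D.gr j, P a b)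
    (hz : ∀ b, P 0 b) (hz' : ∀ a, P a 0) (hadd : ∀ a a' b, P a b → P a' b → P (a + a') b)
    (hadd' : ∀ a b b', P a b → P a b' → P a (b + b')) {n m : g} (hn : n ∈ D.nn)
    (hm : m ∈ D.mm) : P n m := by
  rw [nn] at hn
  rw [mm] at hm
  induction hn using Submodule.iSup_induction' with
  | mem i n hn =>
    induction hm using Submodule.iSup_induction' with
    | mem j m hm => exact h i j i.2 j.2 n hn m hm
    | zero => exact hz' _
    | add x y _ _ hx hy => exact hadd' _ _ _ hx hy
  | zero => exact hz _
  | add x y _ _ hx hy => exact hadd _ _ _ hx hy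

theorem br_nn_mm {n m : g} (hn : n ∈ D.nn) (hm : m ∈ D.mm) : LieSuperalgebra.br n m ∈ D.mm := by
  refine D.nn_mm (P := fun n m => LieSuperalgebra.br n m ∈ D.mm) ?_ ?_ ?_ ?_ ?_ hn hm
  · exact fun i j hi hj a ha b hb => D.gr_le_mm (by linarith) (D.br_mem_gr ha hb)
  · intro b
    simp
  · intro b
    simp
  · intro a a' b h h'
    simpa using add_mem h h'
  · intro a a' b h h'
    simpa using add_mem h h'

theorem form_nn_mm {n m : g} (hn : n ∈ D.nn) (hm : m ∈ D.mm) : D.form n m = 0 := by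
  refine D.nn_mm (P := fun n m => D.form n m = 0) ?_ ?_ ?_ ?_ ?_ hn hm
  · exact fun i j hi hj a ha b hb => D.form_gr_eq_zero (by linarith) ha hb
  · intro b
    simp
  · intro b
    simp
  · intro a a' b h h'
    simp [h, h']
  · intro a a' b h h'
    simp [h, h']

/-- The bracket has degree strictly greater than `1`, while `f`, of degree `-1`, pairs only with
degree `1`. This is why gauge transformations do not move the `-f ⊗ 1` term. -/
theorem form_f_br_nn_mm {n m : g} (hn : n ∈ D.nn) (hm : m ∈ D.mm) :
    D.form D.f (LieSuperalgebra.br n m) = 0 := by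
  refine D.nn_mm (P := fun n m => D.form D.f (LieSuperalgebra.br n m) = 0) ?_ ?_ ?_ ?_ ?_ hn hm
  · exact fun i j hi hj a ha b hb =>
      D.form_gr_eq_zero (by linarith) D.f_mem_gr (D.br_mem_gr ha hb)
  · intro b
    simp
  · intro b
    simp
  · intro a a' b h h'
    simp [h, h']
  · intro a a' b h h'
    simp [h, h']

/-- `ad n` is nilpotent for `n` in an eigenspace of `ad h` of nonzero eigenvalue. -/
theorem isNilpotent_br [FiniteDimensional ℂ g] {i : ℚ} (hi : i ≠ 0) {n : g} (hn : n ∈ D.gr i) :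
    IsNilpotent (LieSuperalgebra.br n : Module.End ℂ g) := by
  by_contra hnil
  rw [IsNilpotent, not_exists] at hnil
  set T : Module.End ℂ g := LieSuperalgebra.br n
  set H : Module.End ℂ g := LieSuperalgebra.br D.h
  have hHT : H * T = T * H + (2 * (i : ℂ)) • T := by
    refine LinearMap.ext fun b => ?_
    simp only [H, T, Module.End.mul_apply, LinearMap.add_apply, LinearMap.smul_apply, br_h_br,
      D.mem_gr.1 hn, map_smul]
    abel
  have hpow : ∀ m : ℕ, H * T ^ m = T ^ m * H + (m * (2 * (i : ℂ))) • T ^ m := by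
    intro m
    induction m with
    | zero => simp
    | succ m ih =>
      rw [pow_succ, ← mul_assoc, ih, add_mul, mul_assoc, hHT, mul_add, smul_mul_assoc,
        mul_smul_comm, add_assoc, ← add_smul, mul_assoc]
      push_cast
      congr 2
      ring
  let A : Module.End ℂ (Module.End ℂ g) := LinearMap.mulLeft ℂ H - LinearMap.mulRight ℂ H
  -- If no power of `T = ad n` vanished, the powers `T ^ m` would be eigenvectors of the commutator
  -- with `H = ad h`, for the pairwise distinct eigenvalues `2mi`. That is impossible on a
  -- finite-dimensional space.
  have hA : ∀ m : ℕ, A.HasEigenvalue (m * (2 * (i : ℂ))) := by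
    intro m
    refine Module.End.hasEigenvalue_of_hasEigenvector (x := T ^ m)
      ⟨Module.End.mem_eigenspace_iff.2 ?_, hnil m⟩
    simp only [A, LinearMap.sub_apply, LinearMap.mulLeft_apply, LinearMap.mulRight_apply, hpow]
    abel
  have hinj : Function.Injective fun m : ℕ => (m * (2 * (i : ℂ))) := by
    intro m m' h
    have h2 : (2 * (i : ℂ)) ≠ 0 := mul_ne_zero two_ne_zero (by exact_mod_cast hi)
    exact_mod_cast mul_right_cancel₀ h2 h
  exact Set.infinite_of_injective_forall_mem hinj hA A.finite_hasEigenvalue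

end Grading

/-! ### The phase space described by pairings -/

section Phase

theorem curPair_add (a b : g) (x : D.Cur) :
    D.curPair (a + b) x = D.curPair a x + D.curPair b x :=
  (D.evalBase (0, x)).map_add a b

theorem curPair_rTensor {S S' : g →ₗ[ℂ] g} (h : ∀ a c, D.form (S' a) c = D.form a (S c))
    (a : g) (x : D.Cur) : D.curPair a (LinearMap.rTensor D.VI S' x) = D.curPair (S a) x := by
  induction x using TensorProduct.induction_on with
  | zero => simp
  | add x y hx hy => simp [hx, hy]
  | tmul b F => rw [LinearMap.rTensor_tmul, curPair_tmul, curPair_tmul, h]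

theorem form_proj (i : ZMod 2) (a b : g) : D.form (proj i a) b = D.form a (proj i b) := by
  conv_lhs => rw [← proj_add b]
  conv_rhs => rw [← proj_add a]
  have h0 := D.form_even (proj_mem 0 a) (proj_mem 1 b) zero_ne_one
  have h1 := D.form_even (proj_mem 1 a) (proj_mem 0 b) one_ne_zero
  rcases zmod2_cases i with rfl | rfl <;> simp [h0, h1]

theorem _root_.DrinfeldSokolov.mem_comp_of_proj_eq_zero {i : ZMod 2} {a : g}
    (h : ∀ j, j ≠ i → proj j a = 0) : a ∈ LieSuperalgebra.comp (g := g) i := by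
  have ha := proj_add a
  rcases zmod2_cases i with rfl | rfl
  · rw [h 1 one_ne_zero, add_zero] at ha
    exact ha ▸ proj_mem 0 a
  · rw [h 0 zero_ne_one, zero_add] at ha
    exact ha ▸ proj_mem 1 a

/-- A complement of `𝔪` in each parity: a projection of `g` onto a subspace of the component of
parity `i` with kernel containing `𝔪`. -/
theorem exists_graded_projections : ∃ S : ZMod 2 → g →ₗ[ℂ] g,
    (∀ i a, S i a ∈ LieSuperalgebra.comp (g := g) i) ∧ (∀ i, ∀ m ∈ D.mm, S i m = 0) ∧
    (∀ i a, S i (S i a) = S i a) ∧ (∀ i j a, j ≠ i → S i (proj j a) = 0) ∧ ∀ a, a - (S 0 a + S 1 a) ∈ D.mm := by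
  obtain ⟨U, hU⟩ := Submodule.exists_isCompl D.mm
  let P : g →ₗ[ℂ] g := Submodule.projection _ _ hU
  have hP : ∀ a, P a ∈ D.mm := fun a => by simp [P]
  have hP' : ∀ a ∈ D.mm, P a = a := fun a ha => by simp [P, ha]
  have hpp : ∀ (i : ZMod 2) (a : g), proj i (proj i a) = proj i a := fun i a =>
    proj_self (proj_mem i a)
  -- The complement `U` need not be graded. As `𝔪` is graded, cutting `1 - P` down to each parity
  -- still gives an idempotent that kills `𝔪`.
  refine ⟨fun i => proj i - proj i ∘ₗ P ∘ₗ proj i, ?_, ?_, ?_, ?_, ?_⟩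
  · intro i a
    exact sub_mem (proj_mem i a) (proj_mem i _)
  · intro i m hm
    simp [hP' _ (D.proj_mem_mm i hm), hpp]
  · intro i a
    simp [hpp, hP' _ (D.proj_mem_mm i (hP _))]
  · intro i j a hij
    simp [proj_of_ne hij.symm (proj_mem j a)]
  · intro a
    have h : proj 0 a + proj 1 a - (proj 0 a - proj 0 (P (proj 0 a)) +
        (proj 1 a - proj 1 (P (proj 1 a)))) =
        proj 0 (P (proj 0 a)) + proj 1 (P (proj 1 a)) := by
      abel
    rw [proj_add] at h
    simp only [LinearMap.sub_apply, LinearMap.comp_apply]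
    rw [h]
    exact add_mem (D.proj_mem_mm 0 (hP _)) (D.proj_mem_mm 1 (hP _))

theorem sum_dualBasis_tmul_curPair {ι : Type*} [DecidableEq ι] [Fintype ι]
    (b : Module.Basis ι ℂ g) (x : D.Cur) :
    ∑ i, D.form.dualBasis D.form_nondegenerate b i ⊗ₜ[ℂ] D.curPair (b i) x = x := by
  induction x using TensorProduct.induction_on with
  | zero => simp
  | add x y hx hy =>
    conv_rhs => rw [← hx, ← hy]
    simp [TensorProduct.tmul_add, Finset.sum_add_distrib]
  | tmul a F =>
    have h : ∀ i, D.form a (b i) =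
        (D.form.dualBasis D.form_nondegenerate b).repr a i := fun i =>
      (LinearMap.BilinForm.dualBasis_repr_apply D.form_nondegenerate b a i).symm
    conv_rhs => rw [← (D.form.dualBasis D.form_nondegenerate b).sum_repr a,
      TensorProduct.sum_tmul]
    refine Finset.sum_congr rfl fun i _ => ?_
    rw [curPair_tmul, h, TensorProduct.smul_tmul]

/-- Dual bases recover an element of `g ⊗ V_I(𝔭)` from its pairings. -/
theorem eq_of_curPair_eq [FiniteDimensional ℂ g] {x y : D.Cur} (h : ∀ a, D.curPair a x = D.curPair a y) : x = y := by
  classical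
  rw [← D.sum_dualBasis_tmul_curPair (Module.finBasis ℂ g) x,
    ← D.sum_dualBasis_tmul_curPair (Module.finBasis ℂ g) y]
  simp only [h]

/-- A characterization of the phase space by pairings. -/
theorem mem_phase_of_curPair [FiniteDimensional ℂ g] {q : D.Cur} (hm : ∀ m ∈ D.mm, D.curPair m q = 0)
    (hq : ∀ (i : ZMod 2) (a : g), a ∈ LieSuperalgebra.comp (g := g) i →
      D.curPair a q ∈ D.compVI i) : q ∈ D.phase := by
  classical
  obtain ⟨S, hS, hSm, hSS, hSj, hS1⟩ := D.exists_graded_projections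
  -- The adjoint of `S i` takes values in `𝔪^⊥`, because `S i` kills `𝔪`, and in parity `i`, because
  -- `S i` kills the other parity and the form is even.
  have hadj : ∀ i, ∃ S' : g →ₗ[ℂ] g, ∀ a c, D.form (S' a) c = D.form a (S i c) := fun i =>
    ⟨D.form.leftAdjointOfNondegenerate D.form_nondegenerate (S i),
      D.form.isAdjointPairLeftAdjointOfNondegenerate D.form_nondegenerate (S i)⟩
  choose S' hS' using hadj
  have hmem : ∀ i, LinearMap.rTensor D.VI (S' i) q ∈ D.phase := by
    intro i
    -- Applying the idempotent adjoint twice serves both tensor factors: the outer copy puts the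
    -- vectors of the dual basis expansion in `𝔪^⊥`, the inner one turns the coefficients into
    -- pairings with vectors of parity `i`.
    have h1 : LinearMap.rTensor D.VI (S' i) q =
        LinearMap.rTensor D.VI (S' i) (LinearMap.rTensor D.VI (S' i) q) :=
      D.eq_of_curPair_eq fun a => by
        rw [D.curPair_rTensor (hS' i), D.curPair_rTensor (hS' i), D.curPair_rTensor (hS' i), hSS]
    rw [h1, ← D.sum_dualBasis_tmul_curPair (Module.finBasis ℂ g) (LinearMap.rTensor D.VI (S' i) q),
      map_sum]
    refine sum_mem fun j _ => ?_
    rw [LinearMap.rTensor_tmul, D.curPair_rTensor (hS' i)]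
    refine D.tmul_mem_evenPart (i := i) ?_ ?_ (hq i _ (hS i _))
    · intro v hv
      rw [hS', hSm i v hv, map_zero]
    · refine mem_comp_of_proj_eq_zero fun l hl => D.form_nondegenerate.1 _ fun c => ?_
      rw [form_proj, hS', hSj i l c hl, map_zero]
  -- Both sides have the same pairings: `a` and `S 0 a + S 1 a` differ by an element of `𝔪`, which
  -- pairs to zero with `q`.
  have h2 : q = LinearMap.rTensor D.VI (S' 0) q + LinearMap.rTensor D.VI (S' 1) q := by
    refine D.eq_of_curPair_eq fun a => ?_
    have h3 := hm _ (hS1 a)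
    rw [map_add, D.curPair_rTensor (hS' 0), D.curPair_rTensor (hS' 1), ← D.curPair_add]
    conv_lhs => rw [← sub_add_cancel a (S 0 a + S 1 a), D.curPair_add, h3, zero_add]
  rw [h2]
  exact add_mem (hmem 0) (hmem 1)

end Phase

/-! ### The generic point of the phase space -/

section GenericPoint

variable [FiniteDimensional ℂ g]

/-- The canonical element `∑ᵢ bⁱ ⊗ bᵢ` of `g ⊗ V_I(𝔭)` for dual bases `bⁱ`, `bᵢ` of `g`. -/
noncomputable def canonicalElement : D.Cur :=
  ∑ i, D.form.dualBasis D.form_nondegenerate (Module.finBasis ℂ g) i ⊗ₜ[ℂ]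
    D.quo (Aff.incl (Module.finBasis ℂ g i))

theorem curPair_canonicalElement (a : g) :
    D.curPair a D.canonicalElement = D.quo (Aff.incl a) := by
  let φ : g →ₗ[ℂ] D.VI := D.evalBase (0, D.canonicalElement)
  let ψ : g →ₗ[ℂ] D.VI := D.quo.toLinearMap ∘ₗ Aff.gen g ∘ₗ TensorProduct.mk ℂ _ g 1
  have h : φ = ψ := by
    refine (Module.finBasis ℂ g).ext fun j => ?_
    change D.curPair (Module.finBasis ℂ g j) D.canonicalElement =
      D.quo (Aff.incl (Module.finBasis ℂ g j))
    simp [canonicalElement, curPair_tmul, LinearMap.BilinForm.apply_dualBasis_left]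
  exact LinearMap.congr_fun h a

/-- In `V_I(𝔭)` each `m ∈ 𝔪` equals `-(f|m)`, so adding `f ⊗ 1` cancels exactly the pairings with
`𝔪`. -/
theorem canonicalElement_add_mem_phase : D.canonicalElement + D.f ⊗ₜ 1 ∈ D.phase := by
  refine D.mem_phase_of_curPair ?_ ?_
  · intro m hm
    rw [map_add, curPair_canonicalElement, D.quo_incl hm, curPair_tmul,
      Algebra.algebraMap_eq_smul_one, neg_add_cancel]
  · intro i a ha
    rw [map_add, curPair_canonicalElement]
    exact add_mem (D.quo_gen_mem_compVI ha 1) (D.curPair_mem ha D.tmul_one_mem_evenPart)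

/-- The point of the phase space at which every `P ∈ V_I(𝔭)` takes the value `P`. -/
noncomputable def genericPoint : D.phase := ⟨_, D.canonicalElement_add_mem_phase⟩

theorem lax_genericPoint (k : ℂ) : D.lax k D.genericPoint = (k, D.canonicalElement) := by
  simp [lax, genericPoint]

end GenericPoint

/-- An algebra homomorphism from `S(ℂ[∂] ⊗ g)` that commutes with `∂` and has the values
`p ↦ p(q)` on `g` is the evaluation at `q`. -/
theorem eq_eval_quo (k : ℂ) (q : D.phase) {φ : Aff g →ₐ[ℂ] D.VI}
    (hφ : ∀ x, φ (Aff.deriv x) = D.derivVI (φ x))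
    (h : ∀ a, φ (Aff.incl a) = D.curPair a (D.lax k q).2) (x : Aff g) :
    φ x = D.eval k q (D.quo x) := by
  refine Aff.hom_ext_incl (ψ := (D.eval k q).comp D.quo) hφ (fun x => ?_) (fun a => ?_) x
  · rw [AlgHom.comp_apply, ← derivVI_quo, eval_deriv, AlgHom.comp_apply]
  · rw [h, AlgHom.comp_apply, eval, liftVI_quo, Aff.incl, Aff.lift_gen, evalGen_tmul, map_one,
      Module.End.one_apply]

theorem eval_genericPoint [FiniteDimensional ℂ g] (k : ℂ) (P : D.VI) :
    D.eval k D.genericPoint P = P := by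
  obtain ⟨x, rfl⟩ := D.quo_surjective P
  refine (D.eq_eval_quo k D.genericPoint (fun x => (D.derivVI_quo x).symm) (fun a => ?_) x).symm
  rw [lax_genericPoint, curPair_canonicalElement]

/-! ### Evaluation along a polynomial curve in `g ⊗ V_I(𝔭)` -/

section Path

variable (N : ℕ) (w : ℕ → D.Cur)

/-- `p ↦ ∑ₙ p(wₙ) tⁿ` for `p ∈ g`. -/
noncomputable def pathBase : g →ₗ[ℂ] Polynomial D.VI :=
  ∑ n ∈ Finset.range (N + 1),
    ((Polynomial.monomial n).restrictScalars ℂ : D.VI →ₗ[ℂ] Polynomial D.VI) ∘ₗ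
      D.evalBase (0, w n)

theorem pathBase_apply (a : g) : D.pathBase N w a =
    ∑ n ∈ Finset.range (N + 1), Polynomial.monomial n (D.curPair a (w n)) := by
  simp [pathBase, evalBase]

/-- `u(∂)p ↦ u(∂)(∑ₙ p(wₙ) tⁿ)` for `p ∈ g`. -/
noncomputable def pathGen : Gens g →ₗ[ℂ] Polynomial D.VI :=
  TensorProduct.lift ((Polynomial.aeval
    (coeffwise D.derivVI : Module.End ℂ (Polynomial D.VI))).toLinearMap.compl₂ (D.pathBase N w))

theorem pathGen_tmul (u : Polynomial ℂ) (a : g) : D.pathGen N w (u ⊗ₜ a) =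
    Polynomial.aeval (coeffwise D.derivVI : Module.End ℂ (Polynomial D.VI)) u
      (D.pathBase N w a) := by
  simp [pathGen]

variable {w}

theorem pathGen_mem (hw : ∀ n, w n ∈ D.evenPart ⊤) {i : ZMod 2} {a : g} (ha : a ∈ LieSuperalgebra.comp i)
    (u : Polynomial ℂ) : D.pathGen N w (u ⊗ₜ a) ∈ D.polyCompVI i := by
  rw [pathGen_tmul]
  refine D.aeval_coeffwise_mem ?_ u
  rw [pathBase_apply]
  exact sum_mem fun n _ => D.monomial_mem_polyCompVI (D.curPair_mem ha (hw n)) n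

theorem pathGen_superComm (hw : ∀ n, w n ∈ D.evenPart ⊤) :
    Aff.IsSuperComm (D.pathGen N w) := fun _ _ _ _ ha hb u v =>
  D.polyCompVI_superComm (D.pathGen_mem N hw ha u) (D.pathGen_mem N hw hb v)

variable (hw : ∀ n, w n ∈ D.evenPart ⊤)

/-- The evaluation of elements of `S(ℂ[∂] ⊗ g)` along the curve `∑ₙ wₙ tⁿ` in `g ⊗ V_I(𝔭)`. -/
noncomputable def pathHom : Aff g →ₐ[ℂ] Polynomial D.VI :=
  Aff.lift (D.pathGen N w) (D.pathGen_superComm N hw)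

theorem pathHom_incl (a : g) : D.pathHom N hw (Aff.incl a) =
    ∑ n ∈ Finset.range (N + 1), Polynomial.monomial n (D.curPair a (w n)) := by
  rw [pathHom, Aff.incl, Aff.lift_gen, pathGen_tmul, map_one, Module.End.one_apply, pathBase_apply]

theorem pathHom_gen_mem {i : ZMod 2} {a : g} (ha : a ∈ LieSuperalgebra.comp i)
    (u : Polynomial ℂ) : D.pathHom N hw (Aff.gen g (u ⊗ₜ a)) ∈ D.polyCompVI i := by
  rw [pathHom, Aff.lift_gen]
  exact D.pathGen_mem N hw ha u

theorem coeffwise_derivVI_mul (p q : Polynomial D.VI) : coeffwise D.derivVI (p * q) =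
    p * coeffwise D.derivVI q + coeffwise D.derivVI p * q := coeffwise_mul D.derivVI_mul p q

theorem coeffwise_derivVI_algebraMap (c : ℂ) :
    coeffwise D.derivVI (algebraMap ℂ (Polynomial D.VI) c) = 0 := by
  rw [Polynomial.algebraMap_apply, coeffwise_C, derivVI_algebraMap, map_zero]

theorem pathHom_deriv (x : Aff g) : D.pathHom N hw (Aff.deriv x) =
    coeffwise D.derivVI (D.pathHom N hw x) := by
  induction x using Aff.induction with
  | h_alg c =>
    rw [Aff.deriv_algebraMap, map_zero, AlgHom.commutes, coeffwise_derivVI_algebraMap]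
  | h_gen i a ha u =>
    rw [Aff.deriv_gen, pathHom, Aff.lift_gen, Aff.lift_gen, pathGen_tmul, pathGen_tmul, map_mul,
      Polynomial.aeval_X, Module.End.mul_apply]
  | h_mul x y hx hy => rw [Aff.deriv_mul, map_add, map_mul, map_mul, hx, hy, map_mul,
      coeffwise_derivVI_mul]
  | h_add x y hx hy => rw [map_add, map_add, map_add, map_add, hx, hy]

/-- Specializing `t = c` gives a homomorphism commuting with `∂`, so only the values on `g` have to
be compared. -/
theorem evalAt_pathHom (k c : ℂ) (q : D.phase)
    (hq : (D.lax k q).2 = ∑ n ∈ Finset.range (N + 1), c ^ n • w n) (x : Aff g) :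
    evalAt D.VI c (D.pathHom N hw x) = D.eval k q (D.quo x) := by
  refine D.eq_eval_quo k q (φ := (evalAt D.VI c).comp (D.pathHom N hw)) (fun x => ?_)
    (fun a => ?_) x
  · rw [AlgHom.comp_apply, pathHom_deriv, evalAt_coeffwise, AlgHom.comp_apply]
  · rw [AlgHom.comp_apply, pathHom_incl, hq]
    simp only [map_sum, evalAt_monomial, map_smul]

/-- The two conditions say that `m + (f|m)` vanishes identically along the curve: the constant term
contributes `-(f|m)` and the higher terms nothing. Compatibility with `∂` extends this to all of
`I`. -/
theorem pathHom_eq_zero (h0 : ∀ m ∈ D.mm, D.curPair m (w 0) = -algebraMap ℂ _ (D.form D.f m))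
    (h1 : ∀ m ∈ D.mm, ∀ n, D.curPair m (w (n + 1)) = 0) {x : Aff g} (hx : D.quo x = 0) :
    D.pathHom N hw x = 0 := by
  have hd : ∀ (r : ℕ) (y : Aff g), D.pathHom N hw ((Aff.deriv ^ r) y) =
      (coeffwise D.derivVI ^ r) (D.pathHom N hw y) := by
    intro r y
    induction r with
    | zero => rfl
    | succ r ih =>
      rw [pow_succ', Module.End.mul_apply, pathHom_deriv, ih, pow_succ', Module.End.mul_apply]
  have hI : ∀ (r : ℕ) ⦃m : g⦄, m ∈ D.mm →
      D.pathHom N hw ((Aff.deriv ^ r) (Aff.incl m + algebraMap ℂ _ (D.form D.f m))) = 0 := by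
    intro r m hm
    rw [hd, map_add, AlgHom.commutes, pathHom_incl, Finset.sum_range_succ', h0 m hm]
    simp [h1 m hm, Polynomial.algebraMap_apply]
  rw [← D.liftVI_quo _ hI, hx, map_zero]

end Path

/-! ### The `λ`-bracket as a derivative along gauge orbits -/

section GaugeDerivation

variable (ev : Aff g →ₐ[ℂ] Polynomial D.VI)

/-- `∑ᵢ cᵢ λⁱ ↦ ∑ᵢ (∂ⁱF) ev(cᵢ)`. -/
noncomputable def lambdaAct (F : D.VI) : Polynomial (Aff g) →ₗ[ℂ] Polynomial D.VI :=
  Polynomial.lsum fun i => LinearMap.mulLeft ℂ (C ((D.derivVI ^ i) F)) ∘ₗ ev.toLinearMap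

theorem lambdaAct_monomial (F : D.VI) (i : ℕ) (c : Aff g) :
    D.lambdaAct ev F (Polynomial.monomial i c) = C ((D.derivVI ^ i) F) * ev c := by
  simp [lambdaAct, Polynomial.lsum, Polynomial.sum_monomial_index]

theorem lambdaAct_C (F : D.VI) (c : Aff g) : D.lambdaAct ev F (C c) = C F * ev c :=
  D.lambdaAct_monomial ev F 0 c

theorem lambdaAct_eq_sum (F : D.VI) (p : Polynomial (Aff g)) : D.lambdaAct ev F p =
    ∑ i ∈ Finset.range (p.natDegree + 1), C ((D.derivVI ^ i) F) * ev (p.coeff i) := by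
  conv_lhs => rw [p.as_sum_range]
  rw [map_sum]
  exact Finset.sum_congr rfl fun i _ => D.lambdaAct_monomial ev F i _

theorem lambdaAct_mul_C (F : D.VI) (p : Polynomial (Aff g)) (y : Aff g) :
    D.lambdaAct ev F (p * C y) = D.lambdaAct ev F p * ev y := by
  induction p using Polynomial.induction_on' with
  | add p q hp hq => rw [add_mul, map_add, map_add, add_mul, hp, hq]
  | monomial i c =>
    rw [Polynomial.monomial_mul_C, lambdaAct_monomial, lambdaAct_monomial, map_mul, mul_assoc]

variable {ev}

theorem mul_ev_sigmaPow (hev : ∀ {i : ZMod 2} {a : g}, a ∈ LieSuperalgebra.comp i →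
      ∀ u : Polynomial ℂ, ev (Aff.gen g (u ⊗ₜ a)) ∈ D.polyCompVI i)
    {j : ZMod 2} {v : Polynomial D.VI} (hv : v ∈ D.polyCompVI j) (x : Aff g) :
    v * ev (Aff.sigmaPow j x) = ev x * v := by
  induction x using Aff.induction with
  | h_alg c => rw [AlgHom.commutes, AlgHom.commutes]; exact (Algebra.commutes c _).symm
  | h_gen i a ha u =>
    rw [Aff.sigmaPow_gen j ha, map_smul, D.polyCompVI_superComm (hev ha u) hv, mul_smul_comm,
      superSign_comm]
  | h_mul x y hx hy => rw [map_mul, map_mul, ← mul_assoc, hx, mul_assoc, hy, map_mul, mul_assoc]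
  | h_add x y hx hy => rw [map_add, map_add, mul_add, hx, hy, map_add, add_mul]

/-- The sign in the Leibniz rule of `{n_λ ·}` is undone by moving `F`, which has the parity of `n`,
past `x`. Thus an odd bracket paired with an odd `F` becomes an ordinary derivation. -/
theorem lambdaAct_C_mul (hev : ∀ {i : ZMod 2} {a : g}, a ∈ LieSuperalgebra.comp i →
      ∀ u : Polynomial ℂ, ev (Aff.gen g (u ⊗ₜ a)) ∈ D.polyCompVI i)
    {j : ZMod 2} {F : D.VI} (hF : F ∈ D.compVI j) (x : Aff g) (p : Polynomial (Aff g)) :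
    D.lambdaAct ev F (C (Aff.sigmaPow j x) * p) = ev x * D.lambdaAct ev F p := by
  induction p using Polynomial.induction_on' with
  | add p q hp hq => rw [mul_add, map_add, map_add, mul_add, hp, hq]
  | monomial i c =>
    rw [Polynomial.C_mul_monomial, lambdaAct_monomial, lambdaAct_monomial, map_mul, ← mul_assoc,
      ← mul_assoc]
    congr 1
    exact D.mul_ev_sigmaPow hev (D.monomial_mem_polyCompVI (D.derivVI_pow_mem hF i) 0) x

/-- By the product rule `∂((∂ⁱF) c) = (∂ⁱ⁺¹F) c + (∂ⁱF) ∂c`; the first term is the action of `λ`.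
Hence sesquilinearity of the bracket becomes commutation with `∂`. -/
theorem lambdaAct_lamPlusDeriv
    (hev : ∀ x, ev (Aff.deriv x) = coeffwise D.derivVI (ev x)) (F : D.VI)
    (p : Polynomial (Aff g)) :
    D.lambdaAct ev F (lamPlusDeriv p) = coeffwise D.derivVI (D.lambdaAct ev F p) := by
  induction p using Polynomial.induction_on' with
  | add p q hp hq => rw [map_add, map_add, map_add, map_add, hp, hq]
  | monomial i c =>
    have h : lamPlusDeriv (Polynomial.monomial i c) =
        Polynomial.monomial (i + 1) c + Polynomial.monomial i (Aff.deriv c) := by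
      rw [lamPlusDeriv, LinearMap.add_apply, LinearMap.mulLeft_apply, coeffwise_monomial,
        Polynomial.X_mul_monomial]
    rw [h, map_add, lambdaAct_monomial, lambdaAct_monomial, lambdaAct_monomial, hev,
      coeffwise_derivVI_mul, coeffwise_C, pow_succ', Module.End.mul_apply, add_comm]

/-- `Θ` is the derivation along `ev`, commuting with `∂`, whose values on `g` are those of the
bracket with `Y` along the curve `∑ₙ wₙ tⁿ`. -/
structure IsGaugeDerivation (ev : Aff g →ₐ[ℂ] Polynomial D.VI) (N : ℕ) (w : ℕ → ℂ × D.Cur)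
    (Y : D.Cur) (Θ : Aff g →ₗ[ℂ] Polynomial D.VI) : Prop where
  map_mul : ∀ x y, Θ (x * y) = ev x * Θ y + Θ x * ev y
  map_deriv : ∀ x, Θ (Aff.deriv x) = coeffwise D.derivVI (Θ x)
  map_incl : ∀ a, Θ (Aff.incl a) = ∑ n ∈ Finset.range (N + 1),
    Polynomial.monomial n (D.curPair a (D.semiAd (0, Y) (w n)).2)

/-- The bridge between the two sides of the theorem: substituting `λⁱ ↦ ∂ⁱF` in `-{n_λ ·}` gives the
infinitesimal gauge transformation by `n ⊗ F`. On `g` the `[n, a]` part matches the bracket with the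
current, and the `k λ (n|a)` part matches the bracket with `k∂`. -/
theorem isGaugeDerivation_tmul (k : ℂ) (N : ℕ) {w : ℕ → ℂ × D.Cur}
    (hw : ∀ n, (w n).2 ∈ D.evenPart ⊤) (hw0 : (w 0).1 = k) (hw1 : ∀ n, (w (n + 1)).1 = 0)
    {j : ZMod 2} {n : g} (hn : n ∈ LieSuperalgebra.comp j) {F : D.VI} (hF : F ∈ D.compVI j) :
    D.IsGaugeDerivation (D.pathHom N hw) N w (n ⊗ₜ F)
      (-(D.lambdaAct (D.pathHom N hw) F ∘ₗ D.adLambda k n)) where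
  map_mul x y := by
    have h : D.adLambda k n (x * y) =
        C (Aff.sigmaPow j x) * D.adLambda k n y + D.adLambda k n x * C y := by
      rw [D.adLambda_of_mem k hn, adLambdaComp, Aff.twistedDer_mul]
      rfl
    simp only [LinearMap.neg_apply, LinearMap.comp_apply, h, map_add, lambdaAct_mul_C,
      D.lambdaAct_C_mul (D.pathHom_gen_mem N hw) hF]
    rw [mul_neg, neg_mul, neg_add]
  map_deriv x := by
    simp only [LinearMap.neg_apply, LinearMap.comp_apply, adLambda_deriv, map_neg,
      D.lambdaAct_lamPlusDeriv (D.pathHom_deriv N hw)]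
  map_incl a := by
    have hX : D.lambdaAct (D.pathHom N hw) F X = C (D.derivVI F) := by
      rw [← Polynomial.monomial_one_one_eq_X, lambdaAct_monomial, map_one, mul_one, pow_one]
    have hC : D.lambdaAct (D.pathHom N hw) F (C (Aff.incl (LieSuperalgebra.br n a))) =
        ∑ l ∈ Finset.range (N + 1),
          Polynomial.monomial l (F * D.curPair (LieSuperalgebra.br n a) (w l).2) := by
      rw [lambdaAct_C, pathHom_incl, Finset.mul_sum]
      simp only [Polynomial.C_mul_monomial]
    -- Only the constant term of the curve contains `k∂`, so the central term sits in degree `0` in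
    -- `t`.
    have hk : ∑ l ∈ Finset.range (N + 1),
        Polynomial.monomial l (((w l).1 * D.form n a) • D.derivVI F) =
          (k * D.form n a) • C (D.derivVI F) := by
      rw [Finset.sum_range_succ', hw0]
      simp [hw1, Polynomial.smul_C]
    simp only [LinearMap.neg_apply, LinearMap.comp_apply, adLambda_incl, map_add, map_smul, hX, hC,
      D.curPair_semiAd_tmul hn hF (hw _), map_neg, Finset.sum_neg_distrib, Finset.sum_add_distrib,
      hk]

/-- Along an integral curve of the bracket with `Y`, the gauge derivation is the derivative. -/
theorem derivative_pathHom {N : ℕ} {w : ℕ → ℂ × D.Cur} (hw : ∀ n, (w n).2 ∈ D.evenPart ⊤)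
    {Y : D.Cur} (hstep : ∀ n : ℕ, ((n : ℂ) + 1) • w (n + 1) = D.semiAd (0, Y) (w n))
    (hN : D.semiAd (0, Y) (w N) = 0) {Θ : Aff g →ₗ[ℂ] Polynomial D.VI}
    (hΘ : D.IsGaugeDerivation (D.pathHom N hw) N w Y Θ) (x : Aff g) :
    Polynomial.derivative (D.pathHom N hw x) = Θ x := by
  induction x using Aff.induction with
  | h_alg c =>
    have h1 : Θ 1 = 0 := by
      have := hΘ.map_mul 1 1
      simpa using this
    rw [AlgHom.commutes, Polynomial.algebraMap_apply, Polynomial.derivative_C,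
      Algebra.algebraMap_eq_smul_one, map_smul, h1, smul_zero]
  | h_gen i a ha u =>
    refine Aff.eq_gen_of_eq_incl
      (φ := (Polynomial.derivative.restrictScalars ℂ) ∘ₗ (D.pathHom N hw).toLinearMap) (ψ := Θ)
      (δ := coeffwise D.derivVI) (fun x => ?_) hΘ.map_deriv ?_ u
    · change Polynomial.derivative (D.pathHom N hw (Aff.deriv x)) =
        coeffwise D.derivVI (Polynomial.derivative (D.pathHom N hw x))
      rw [pathHom_deriv, coeffwise_derivative]
    · change Polynomial.derivative (D.pathHom N hw (Aff.incl a)) = Θ (Aff.incl a)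
      -- The derivative removes the degree `0` term on the left, and `hN` removes the top term on
      -- the right. The remaining sums match after a shift by one, through `hstep`.
      rw [hΘ.map_incl, pathHom_incl, Finset.sum_range_succ', Finset.sum_range_succ, hN, map_add,
        map_sum]
      simp only [Polynomial.derivative_monomial, Prod.snd_zero, map_zero, add_zero,
        Nat.add_sub_cancel, Nat.cast_zero, mul_zero]
      refine Finset.sum_congr rfl fun l _ => ?_
      rw [← hstep, Prod.smul_snd, map_smul, Algebra.smul_def, Algebra.commutes]
      simp
  | h_mul x y hx hy =>
    rw [map_mul, Polynomial.derivative_mul, hx, hy, hΘ.map_mul, add_comm]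
  | h_add x y hx hy => rw [map_add, map_add, map_add, hx, hy]

end GaugeDerivation

/-! ### Reduction to homogeneous eigenvectors in `𝔫` -/

section Linearity

theorem adLambdaComp_add (k : ℂ) (i : ZMod 2) (a b : g) :
    D.adLambdaComp k i (a + b) = D.adLambdaComp k i a + D.adLambdaComp k i b := by
  refine LinearMap.ext fun x => ?_
  simp only [adLambdaComp, LinearMap.add_apply]
  induction x using Aff.induction with
  | h_alg c => simp only [Aff.twistedDer_algebraMap, add_zero]
  | h_gen j c hc u =>
    rw [Aff.twistedDer_gen, Aff.twistedDer_gen, Aff.twistedDer_gen, lambdaGen_tmul,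
      lambdaGen_tmul, lambdaGen_tmul, ← map_add]
    congr 1
    simp only [lambdaBase, LinearMap.coe_mk, AddHom.coe_mk, map_add, LinearMap.add_apply,
      Aff.incl, TensorProduct.tmul_add, mul_add, add_smul]
    abel
  | h_mul x y hx hy =>
    rw [Aff.twistedDer_mul, Aff.twistedDer_mul, Aff.twistedDer_mul, hx, hy, mul_add, add_mul]
    abel
  | h_add x y hx hy => rw [map_add _ x y, map_add _ x y, map_add _ x y, hx, hy]; abel

theorem adLambda_add (k : ℂ) (a b : g) :
    D.adLambda k (a + b) = D.adLambda k a + D.adLambda k b := by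
  simp only [adLambda, adLambdaComp_add]
  abel

theorem adLambda_zero (k : ℂ) : D.adLambda k 0 = 0 := by
  simpa using D.adLambda_add k 0 0

/-- The condition `{n_λ A} ∈ I[λ]` for `n ∈ 𝔫` has to be checked for homogeneous eigenvectors `n`
of `ad h` only. -/
theorem map_adLambda_eq_zero (k : ℂ) {A : Aff g}
    (h : ∀ i : ℚ, 0 < i → ∀ (j : ZMod 2), ∀ n ∈ D.gr i, n ∈ LieSuperalgebra.comp (g := g) j →
      (D.adLambda k n A).map (D.quo : Aff g →+* D.VI) = 0) {n : g} (hn : n ∈ D.nn) :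
    (D.adLambda k n A).map (D.quo : Aff g →+* D.VI) = 0 := by
  rw [nn] at hn
  induction hn using Submodule.iSup_induction' with
  | mem i n hn =>
    rw [← proj_add n, adLambda_add, LinearMap.add_apply, Polynomial.map_add,
      h i i.2 0 _ (D.proj_mem_gr i 0 hn) (proj_mem 0 n),
      h i i.2 1 _ (D.proj_mem_gr i 1 hn) (proj_mem 1 n), add_zero]
  | zero => rw [adLambda_zero, LinearMap.zero_apply, Polynomial.map_zero]
  | add x y _ _ hx hy => rw [adLambda_add, LinearMap.add_apply, Polynomial.map_add, hx, hy,
      add_zero]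

end Linearity

/-! ### The exponential curve and its pairings with `𝔪` -/

section Exponential

/-- Pairing with `m` after bracketing with `n ⊗ F` means pairing with `[n, m] ∈ 𝔪`, where `f`
vanishes, plus a multiple of `(n|m) = 0`. The scalar `s` covers the Lax operator itself (`s = -1`)
and the later terms of the series (`s = 0`). -/
theorem curPair_semiAd_of_mem_mm {Y : D.Cur} (hY : Y ∈ D.evenPart D.nn) {Z : ℂ × D.Cur}
    (hZ : Z.2 ∈ D.evenPart ⊤) {s : ℂ}
    (hZm : ∀ m ∈ D.mm, D.curPair m Z.2 = s • algebraMap ℂ D.VI (D.form D.f m)) {m : g}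
    (hm : m ∈ D.mm) : D.curPair m (D.semiAd (0, Y) Z).2 = 0 := by
  induction hY using Submodule.span_induction with
  | mem Y hY =>
    obtain ⟨i, n, F, hnn, hn, hF, rfl⟩ := hY
    rw [D.curPair_semiAd_tmul hn hF hZ, hZm _ (D.br_nn_mm hnn hm), D.form_f_br_nn_mm hnn hm,
      D.form_nn_mm hnn hm]
    simp
  | zero => simp [semiAd_zero]
  | add Y Y' _ _ h h' => rw [semiAd_add, Prod.snd_add, map_add, h, h', add_zero]
  | smul c Y _ h => rw [semiAd_smul, LinearMap.smul_apply, Prod.smul_snd, map_smul, h, smul_zero]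

/-- The terms `(1/n!) (ad Y)^n (k∂ + q - f ⊗ 1)` of the exponential series. -/
noncomputable def expTerm (k : ℂ) (Y q : D.Cur) (n : ℕ) : ℂ × D.Cur :=
  ((n.factorial : ℂ)⁻¹) • (D.semiAd (0, Y) ^ n) (D.lax k q)

variable (k : ℂ)

theorem expTerm_zero (Y q : D.Cur) : D.expTerm k Y q 0 = D.lax k q := by
  simp [expTerm]

/-- Coefficient form of the differential equation `w' = [Y, w]` for `w(t) = e^{t ad Y} L`. -/
theorem expTerm_succ (Y q : D.Cur) (n : ℕ) :
    ((n : ℂ) + 1) • D.expTerm k Y q (n + 1) = D.semiAd (0, Y) (D.expTerm k Y q n) := by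
  have h : (n : ℂ) + 1 ≠ 0 := by exact_mod_cast n.succ_ne_zero
  rw [expTerm, expTerm, map_smul, ← Module.End.mul_apply, ← pow_succ', smul_smul,
    Nat.factorial_succ]
  push_cast
  rw [mul_inv, mul_inv_cancel_left₀ h]

theorem expTerm_zero_fst (Y q : D.Cur) : (D.expTerm k Y q 0).1 = k := by
  rw [expTerm_zero]
  rfl

theorem expTerm_succ_fst (Y q : D.Cur) (n : ℕ) : (D.expTerm k Y q (n + 1)).1 = 0 := by
  rw [expTerm, Prod.smul_fst, semiAd_pow_succ_fst, smul_zero]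

variable {k} {Y q : D.Cur}

theorem expTerm_snd_mem (hY : Y ∈ D.evenPart ⊤) (hq : q ∈ D.evenPart ⊤) (n : ℕ) :
    (D.expTerm k Y q n).2 ∈ D.evenPart ⊤ :=
  Submodule.smul_mem _ _ (D.semiAd_pow_snd_mem hY (D.lax_snd_mem k hq) n)

theorem curPair_expTerm_zero (hq : q ∈ D.phase) {m : g} (hm : m ∈ D.mm) :
    D.curPair m (D.expTerm k Y q 0).2 = -algebraMap ℂ _ (D.form D.f m) := by
  rw [expTerm_zero, lax, map_sub, D.curPair_phase hm hq, curPair_tmul, zero_sub,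
    Algebra.algebraMap_eq_smul_one]

theorem curPair_expTerm_succ (hY : Y ∈ D.evenPart D.nn) (hq : q ∈ D.phase) {m : g}
    (hm : m ∈ D.mm) (n : ℕ) : D.curPair m (D.expTerm k Y q (n + 1)).2 = 0 := by
  have hY' := D.evenPart_mono le_top hY
  have hq' := D.evenPart_mono le_top hq
  have h : (n : ℂ) + 1 ≠ 0 := by exact_mod_cast n.succ_ne_zero
  have key : D.curPair m (D.semiAd (0, Y) (D.expTerm k Y q n)).2 = 0 := by
    induction n generalizing m with
    | zero =>
      refine D.curPair_semiAd_of_mem_mm hY (D.expTerm_snd_mem hY' hq' 0) (s := -1) ?_ hm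
      intro m hm
      rw [D.curPair_expTerm_zero hq hm, neg_smul, one_smul]
    | succ n ih =>
      refine D.curPair_semiAd_of_mem_mm hY (D.expTerm_snd_mem hY' hq' _) (s := 0) ?_ hm
      intro m hm
      have h : (n : ℂ) + 1 ≠ 0 := by exact_mod_cast n.succ_ne_zero
      have := ih hm h
      rw [← expTerm_succ, Prod.smul_snd, map_smul] at this
      rw [(smul_eq_zero.1 this).resolve_left h, zero_smul]
  rw [← expTerm_succ, Prod.smul_snd, map_smul] at key
  exact (smul_eq_zero.1 key).resolve_left h

end Exponential

/-! ### Elements of the W-superalgebra are gauge invariant -/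

section Invariance

variable {k : ℂ}

/-- The conditions on the derivation and its vanishing at `A` are linear in `Y`, so it is built by
adding the derivations of the pure tensors `n ⊗ F` that make up `Y`. -/
theorem exists_isGaugeDerivation {N : ℕ} {w : ℕ → ℂ × D.Cur}
    (hw : ∀ n, (w n).2 ∈ D.evenPart ⊤) (hw0 : (w 0).1 = k) (hw1 : ∀ n, (w (n + 1)).1 = 0)
    {A : Aff g} (hA : ∀ n ∈ D.nn, ∀ i, D.pathHom N hw ((D.adLambda k n A).coeff i) = 0)
    {Y : D.Cur} (hY : Y ∈ D.evenPart D.nn) :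
    ∃ Θ, D.IsGaugeDerivation (D.pathHom N hw) N w Y Θ ∧ Θ A = 0 := by
  induction hY using Submodule.span_induction with
  | mem Y hY =>
    obtain ⟨i, n, F, hnn, hn, hF, rfl⟩ := hY
    refine ⟨_, D.isGaugeDerivation_tmul k N hw hw0 hw1 hn hF, ?_⟩
    rw [LinearMap.neg_apply, LinearMap.comp_apply, lambdaAct_eq_sum]
    simp [hA n hnn]
  | zero =>
    refine ⟨0, ⟨?_, ?_, ?_⟩, ?_⟩ <;> simp [semiAd_zero]
  | add Y Y' _ _ h h' =>
    obtain ⟨Θ, h, hA⟩ := h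
    obtain ⟨Θ', h', hA'⟩ := h'
    refine ⟨Θ + Θ', ⟨?_, ?_, ?_⟩, ?_⟩
    · intro x y
      simp only [LinearMap.add_apply, h.map_mul, h'.map_mul, mul_add, add_mul]
      abel
    · intro x
      simp only [LinearMap.add_apply, h.map_deriv, h'.map_deriv, map_add]
    · intro a
      simp only [LinearMap.add_apply, h.map_incl, h'.map_incl, semiAd_add, Prod.snd_add, map_add,
        Finset.sum_add_distrib]
    · rw [LinearMap.add_apply, hA, hA', add_zero]
  | smul c Y _ h =>
    obtain ⟨Θ, h, hA⟩ := h
    refine ⟨c • Θ, ⟨?_, ?_, ?_⟩, ?_⟩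
    · intro x y
      simp only [LinearMap.smul_apply, h.map_mul, smul_add, mul_smul_comm, smul_mul_assoc]
    · intro x
      simp only [LinearMap.smul_apply, h.map_deriv, map_smul]
    · intro a
      simp only [LinearMap.smul_apply, h.map_incl, semiAd_smul, Prod.smul_snd, map_smul,
        Finset.smul_sum, Polynomial.smul_monomial]
    · rw [LinearMap.smul_apply, hA, smul_zero]

theorem W_le_gaugeInvariants : D.W k ≤ Subalgebra.toSubmodule (D.gaugeInvariants k) := by
  rintro _ ⟨A, hA, rfl⟩ q q' ⟨Y, hY, N, hN, hq'⟩
  have hY' := D.evenPart_mono le_top hY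
  have hq := D.evenPart_mono le_top q.2
  let w := D.expTerm k Y q
  have hw : ∀ n, (w n).2 ∈ D.evenPart ⊤ := D.expTerm_snd_mem hY' hq
  have hpath : ∀ x, D.quo x = 0 → D.pathHom N hw x = 0 := fun x =>
    D.pathHom_eq_zero N hw (fun m hm => D.curPair_expTerm_zero q.2 hm)
      fun m hm n => D.curPair_expTerm_succ hY q.2 hm n
  have hwN : w N = 0 := by
    simp only [w, expTerm, hN, smul_zero]
  obtain ⟨Θ, hΘ, hΘA⟩ := D.exists_isGaugeDerivation (N := N) hw (D.expTerm_zero_fst k Y q)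
    (D.expTerm_succ_fst k Y q) (A := A) (fun n hn i => hpath _ (by
      have := congrArg (fun p => p.coeff i) (hA n hn)
      simpa [Polynomial.coeff_map] using this)) hY
  have hder := D.derivative_pathHom hw (D.expTerm_succ k Y q)
    (show D.semiAd (0, Y) (w N) = 0 by rw [hwN, map_zero]) hΘ A
  rw [hΘA] at hder
  have hC := eq_C_of_derivative_eq_zero hder
  -- The constant polynomial is compared at its endpoints: `t = 0` gives `q` and `t = 1` gives `q'`.
  -- The additional term `w N` of the curve is zero.
  have e0 := D.evalAt_pathHom N hw k 0 q (by
    rw [Finset.sum_range_succ', Finset.sum_eq_zero fun n _ => by rw [zero_pow n.succ_ne_zero,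
      zero_smul], pow_zero, one_smul, zero_add]
    simp only [w, expTerm_zero]) A
  have e1 := D.evalAt_pathHom N hw k 1 q' (by
    rw [hq', Finset.sum_range_succ, hwN, Prod.snd_sum]
    simp [w, expTerm]) A
  rw [hC, evalAt_C] at e0 e1
  exact e0.symm.trans e1

end Invariance

/-! ### Nilpotence of `ad (n ⊗ F)` -/

section Nilpotence

theorem curBr_tmul_eq_map (n : g) {j : ZMod 2} {F : D.VI} (hF : F ∈ D.compVI j) :
    D.curBr (n ⊗ₜ F) = TensorProduct.map
      (LieSuperalgebra.br n ∘ₗ (proj 0 + superSign 1 j • proj 1)) (LinearMap.mulLeft ℂ F) := by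
  ext b G
  simp [curBr, D.mem_compVI.1 hF, TensorProduct.add_tmul, TensorProduct.smul_tmul']

/-- For even `F` this comes from nilpotence of `ad n`. For odd `F` it comes from `F² = 0`, which
already makes the square vanish. -/
theorem isNilpotent_curBr_tmul [FiniteDimensional ℂ g] {i : ℚ} (hi : i ≠ 0) {n : g}
    (hn : n ∈ D.gr i) {j : ZMod 2} {F : D.VI} (hF : F ∈ D.compVI j) :
    IsNilpotent (D.curBr (n ⊗ₜ F) : Module.End ℂ D.Cur) := by
  rw [D.curBr_tmul_eq_map n hF]
  rcases zmod2_cases j with rfl | rfl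
  · obtain ⟨N, hN⟩ := D.isNilpotent_br hi hn
    have h : (LieSuperalgebra.br n ∘ₗ (proj 0 + superSign 1 0 • proj 1) : Module.End ℂ g) =
        LieSuperalgebra.br n := by
      refine LinearMap.ext fun b => ?_
      rw [superSign_zero_right, one_smul, LinearMap.comp_apply, LinearMap.add_apply, proj_add]
    refine ⟨N, ?_⟩
    rw [h, TensorProduct.map_pow, hN, TensorProduct.map_zero_left]
  · have h : F * F = 0 := by
      have := D.superCommVI hF hF
      rw [superSign_one_one, neg_smul, one_smul, eq_neg_iff_add_eq_zero, ← two_smul ℂ] at this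
      exact (smul_eq_zero.1 this).resolve_left two_ne_zero
    refine ⟨2, ?_⟩
    have h2 : (LinearMap.mulLeft ℂ F : Module.End ℂ D.VI) ^ 2 = 0 := by
      refine LinearMap.ext fun G => ?_
      rw [pow_two, Module.End.mul_apply, LinearMap.mulLeft_apply, LinearMap.mulLeft_apply,
        ← mul_assoc, h, zero_mul, LinearMap.zero_apply]
    rw [TensorProduct.map_pow, h2, TensorProduct.map_zero_right]

/-- One application removes the `∂`-component, after which only the bracket of `g ⊗ V_I(𝔭)` acts;
hence the exponent `N + 1`. -/
theorem isNilpotent_semiAd_tmul [FiniteDimensional ℂ g] {i : ℚ} (hi : i ≠ 0) {n : g}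
    (hn : n ∈ D.gr i) {j : ZMod 2} {F : D.VI} (hF : F ∈ D.compVI j) :
    IsNilpotent (D.semiAd (0, n ⊗ₜ F)) := by
  obtain ⟨N, hN⟩ := D.isNilpotent_curBr_tmul hi hn hF
  have h : ∀ (r : ℕ) (Z : ℂ × D.Cur), (D.semiAd (0, n ⊗ₜ F) ^ (r + 1)) Z =
      (0, ((D.curBr (n ⊗ₜ F) : Module.End ℂ D.Cur) ^ r) (D.semiAd (0, n ⊗ₜ F) Z).2) := by
    intro r Z
    induction r with
    | zero => rfl
    | succ r ih =>
      rw [pow_succ', Module.End.mul_apply, ih, pow_succ', Module.End.mul_apply]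
      simp [semiAd]
  refine ⟨N + 1, LinearMap.ext fun Z => ?_⟩
  rw [h, hN]
  rfl

end Nilpotence

/-! ### Isolating coefficients by partial derivatives -/

section Transversal

/-- `u(∂)b ↦ u_M (n|b)`, where `u_M` is the coefficient of `∂^M` in `u`. -/
noncomputable def coeffGen (n : g) (M : ℕ) : Gens g →ₗ[ℂ] D.VI :=
  Algebra.linearMap ℂ D.VI ∘ₗ TensorProduct.lift
    ((LinearMap.mul ℂ ℂ).compl₁₂ (Polynomial.lcoeff ℂ M) (D.form n))

theorem coeffGen_tmul (n : g) (M : ℕ) (u : Polynomial ℂ) (b : g) :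
    D.coeffGen n M (u ⊗ₜ b) = algebraMap ℂ _ (u.coeff M * D.form n b) := by
  simp [coeffGen]

/-- Evenness of the form makes `(n|b)` vanish unless `b` has the parity of `n`, which is when the
signs agree. -/
theorem coeffGen_compat {j : ZMod 2} {n : g} (hn : n ∈ LieSuperalgebra.comp j) (M : ℕ) :
    Aff.IsCompat (D.quo.comp (Aff.sigmaPow j)) D.quo (D.coeffGen n M) := by
  intro i l a b ha hb u v
  simp only [AlgHom.comp_apply, Aff.sigmaPow_gen j ha, Aff.sigmaPow_gen j hb, coeffGen_tmul,
    map_smul]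
  have h1 : superSign j i • (D.quo (Aff.gen g (u ⊗ₜ a)) *
      algebraMap ℂ D.VI (v.coeff M * D.form n b)) =
      superSign i l • (algebraMap ℂ D.VI (v.coeff M * D.form n b) *
        D.quo (Aff.gen g (u ⊗ₜ a))) := by
    by_cases h : j = l
    · subst h
      rw [Algebra.commutes, superSign_comm]
    · rw [D.form_even hn hb h]
      simp
  have h2 : algebraMap ℂ D.VI (u.coeff M * D.form n a) * D.quo (Aff.gen g (v ⊗ₜ b)) =
      superSign i l • (superSign j l • (D.quo (Aff.gen g (v ⊗ₜ b)) *
        algebraMap ℂ D.VI (u.coeff M * D.form n a))) := by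
    by_cases h : j = i
    · subst h
      rw [smul_smul, superSign_mul_self, one_smul, Algebra.commutes]
    · rw [D.form_even hn ha h]
      simp
  rw [smul_mul_assoc, h1, h2, smul_add, smul_mul_assoc, add_comm]

/-- The superderivation along `S(ℂ[∂] ⊗ g) → V_I(𝔭)` with `u(∂)b ↦ u_M (n|b)`. -/
noncomputable def coeffDer {j : ZMod 2} {n : g} (hn : n ∈ LieSuperalgebra.comp j) (M : ℕ) :
    Aff g →ₗ[ℂ] D.VI :=
  Aff.twistedDer _ _ _ (D.coeffGen_compat hn M)

variable {j : ZMod 2} {n : g} (hn : n ∈ LieSuperalgebra.comp (g := g) j)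

theorem coeffDer_gen (M : ℕ) (u : Polynomial ℂ) (b : g) :
    D.coeffDer hn M (Aff.gen g (u ⊗ₜ b)) = algebraMap ℂ _ (u.coeff M * D.form n b) := by
  rw [coeffDer, Aff.twistedDer_gen, coeffGen_tmul]

theorem coeffDer_mul (M : ℕ) (x y : Aff g) : D.coeffDer hn M (x * y) =
    D.quo (Aff.sigmaPow j x) * D.coeffDer hn M y + D.coeffDer hn M x * D.quo y :=
  Aff.twistedDer_mul _ _ _ _ x y

theorem deriv_pow_incl (r : ℕ) (a : g) :
    (Aff.deriv ^ r) (Aff.incl a) = Aff.gen g ((X ^ r : Polynomial ℂ) ⊗ₜ a) := by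
  rw [Aff.gen_eq_aeval_deriv, map_pow, Polynomial.aeval_X]

/-- This superderivation descends to `V_I(𝔭)` because `𝔫` is orthogonal to `𝔪`, so it kills the
generators of `I`. The argument runs through the triangular matrix homomorphism, which kills these
generators and hence factors through the quotient. -/
theorem coeffDer_eq_zero (hnn : n ∈ D.nn) (M : ℕ) {x : Aff g} (hx : D.quo x = 0) :
    D.coeffDer hn M x = 0 := by
  have hI : ∀ (r : ℕ) ⦃m : g⦄, m ∈ D.mm →
      Aff.lift _ (Aff.upper_superComm (D.coeffGen_compat hn M))
        ((Aff.deriv ^ r) (Aff.incl m + algebraMap ℂ _ (D.form D.f m))) = 0 := by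
    intro r m hm
    have hs : D.quo (Aff.sigmaPow j
        ((Aff.deriv ^ r) (Aff.incl m + algebraMap ℂ _ (D.form D.f m)))) = 0 := by
      rcases zmod2_cases j with rfl | rfl
      · exact D.quo_rel r hm
      · exact D.sigmaVI_lift r hm
    have hd : D.coeffDer hn M
        ((Aff.deriv ^ r) (Aff.incl m + algebraMap ℂ _ (D.form D.f m))) = 0 := by
      have hc : D.coeffDer hn M ((Aff.deriv ^ r) (algebraMap ℂ (Aff g) (D.form D.f m))) = 0 := by
        cases r with
        | zero => exact Aff.twistedDer_algebraMap _ _ _ _ _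
        | succ r => rw [pow_succ, Module.End.mul_apply, Aff.deriv_algebraMap, map_zero, map_zero]
      rw [map_add, map_add, hc, deriv_pow_incl, coeffDer_gen, D.form_nn_mm hnn hm, mul_zero,
        map_zero, add_zero]
    rw [Aff.lift_upper _ _ _ (D.coeffGen_compat hn M), AlgHom.comp_apply, hs, D.quo_rel r hm]
    rw [coeffDer] at hd
    rw [hd]
    ext a b
    fin_cases a <;> fin_cases b <;> rfl
  have h := D.liftVI_quo _ hI x
  rw [hx, map_zero] at h
  rw [coeffDer, Aff.twistedDer, LinearMap.comp_apply, AlgHom.toLinearMap_apply, ← h, map_zero]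

/-- An element involves only finitely many derivatives of the generators. -/
theorem exists_coeffDer_eq_zero (x : Aff g) : ∃ B, ∀ M, B ≤ M → D.coeffDer hn M x = 0 := by
  induction x using Aff.induction with
  | h_alg c => exact ⟨0, fun M _ => Aff.twistedDer_algebraMap _ _ _ _ c⟩
  | h_gen i a ha u =>
    refine ⟨u.natDegree + 1, fun M hM => ?_⟩
    rw [coeffDer_gen, Polynomial.coeff_eq_zero_of_natDegree_lt hM, zero_mul, map_zero]
  | h_mul x y hx hy =>
    obtain ⟨B, hB⟩ := hx
    obtain ⟨B', hB'⟩ := hy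
    refine ⟨max B B', fun M hM => ?_⟩
    rw [coeffDer_mul, hB M (le_of_max_le_left hM), hB' M (le_of_max_le_right hM), mul_zero,
      zero_mul, add_zero]
  | h_add x y hx hy =>
    obtain ⟨B, hB⟩ := hx
    obtain ⟨B', hB'⟩ := hy
    refine ⟨max B B', fun M hM => ?_⟩
    rw [map_add, hB M (le_of_max_le_left hM), hB' M (le_of_max_le_right hM), add_zero]

/-- If `∑ᵢ (∂ⁱF) cᵢ = 0` for all `F` of the parity of the nonzero element `n ∈ 𝔫`, then `cᵢ = 0`
for all `i`. -/
theorem quo_eq_zero_of_sum_eq_zero (hn : n ∈ LieSuperalgebra.comp (g := g) j)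
    (hnn : n ∈ D.nn) (hn0 : n ≠ 0) (d : ℕ) (c : ℕ → Aff g)
    (h : ∀ F ∈ D.compVI j, ∑ i ∈ Finset.range d, (D.derivVI ^ i) F * D.quo (c i) = 0) {l : ℕ}
    (hl : l < d) : D.quo (c l) = 0 := by
  obtain ⟨b, hb⟩ : ∃ b, D.form n b ≠ 0 := by
    by_contra! hb
    exact hn0 (D.form_nondegenerate.1 _ hb)
  have hb' : D.form n (proj j b) = D.form n b := by
    rw [← form_proj, proj_self hn]
  set a := proj j ((D.form n b)⁻¹ • b) with ha
  have hna : D.form n a = 1 := by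
    rw [ha, map_smul, map_smul, hb', smul_eq_mul, inv_mul_cancel₀ hb]
  choose B hB using fun i => D.exists_coeffDer_eq_zero hn (c i)
  -- With `F = ∂^N a` the relation involves `∂^(i+N) a`. The choice of `N` makes the derivation at
  -- level `N + l` kill every `c i`, so only the factor `∂^(l+N) a` contributes, and what is left is
  -- `c l`.
  set N := (Finset.range d).sup B
  have hBN : ∀ i ∈ Finset.range d, D.coeffDer hn (N + l) (c i) = 0 := fun i hi =>
    hB i _ ((Finset.le_sup hi).trans (Nat.le_add_right _ _))
  have h0 : D.quo (∑ i ∈ Finset.range d,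
      Aff.gen g ((X ^ (i + N) : Polynomial ℂ) ⊗ₜ a) * c i) = 0 := by
    rw [← h _ (D.quo_gen_mem_compVI (proj_mem j _) (X ^ N)), map_sum]
    refine Finset.sum_congr rfl fun i _ => ?_
    rw [map_mul, derivVI_pow_quo, ← deriv_pow_incl, ← deriv_pow_incl, pow_add,
      Module.End.mul_apply]
  have h1 := D.coeffDer_eq_zero hn hnn (N + l) h0
  rw [map_sum, Finset.sum_eq_single_of_mem l (Finset.mem_range.2 hl)] at h1
  · rwa [coeffDer_mul, hBN l (Finset.mem_range.2 hl), mul_zero, zero_add, coeffDer_gen, hna,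
      Polynomial.coeff_X_pow, if_pos (add_comm N l), mul_one, map_one, one_mul] at h1
  · intro i hi hil
    rw [coeffDer_mul, hBN i hi, mul_zero, zero_add, coeffDer_gen, Polynomial.coeff_X_pow,
      if_neg (by omega), zero_mul, map_zero, zero_mul]

end Transversal

/-! ### Gauge invariant elements lie in the W-superalgebra -/

section Converse

variable [FiniteDimensional ℂ g] {k : ℂ}

/-- A nilpotent `ad Y` with `Y ∈ (𝔫 ⊗ V_I(𝔭))_0` generates a one-parameter family of gauge
transformations. -/
theorem exists_gaugeEquiv (q : D.phase) {Y : D.Cur} (hY : Y ∈ D.evenPart D.nn) {N : ℕ}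
    (hN : D.semiAd (0, Y) ^ N = 0) (c : ℂ) : ∃ q' : D.phase, D.GaugeEquiv k q q' ∧
      (D.lax k q').2 = ∑ n ∈ Finset.range (N + 1), c ^ n • (D.expTerm k Y q n).2 := by
  have hY' := D.evenPart_mono le_top hY
  have hq' := D.evenPart_mono le_top q.2
  set S := ∑ n ∈ Finset.range (N + 1), c ^ n • (D.expTerm k Y q n).2 with hS
  have hSmem : S ∈ D.evenPart ⊤ := sum_mem fun n _ =>
    Submodule.smul_mem _ _ (D.expTerm_snd_mem hY' hq' n)
  -- The terms of positive degree pair to zero with `𝔪`, so the transformed operator is again of the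
  -- form `k∂ + q' - f ⊗ 1` with `q'` in the phase space.
  have hmem : S + D.f ⊗ₜ 1 ∈ D.phase := by
    refine D.mem_phase_of_curPair ?_ fun i a ha =>
      D.curPair_mem ha (add_mem hSmem D.tmul_one_mem_evenPart)
    intro m hm
    have : D.curPair m S = -algebraMap ℂ _ (D.form D.f m) := by
      rw [hS, map_sum, Finset.sum_range_succ', Finset.sum_eq_zero fun n _ => by
        rw [map_smul, D.curPair_expTerm_succ hY q.2 hm, smul_zero], pow_zero, one_smul,
        D.curPair_expTerm_zero q.2 hm, zero_add]
    rw [map_add, this, curPair_tmul, Algebra.algebraMap_eq_smul_one, neg_add_cancel]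
  have hlax : D.lax k (S + D.f ⊗ₜ 1) = (k, S) := by
    simp [lax]
  have hpow : ∀ n, D.semiAd (0, c • Y) ^ n = c ^ n • D.semiAd (0, Y) ^ n := fun n => by
    rw [semiAd_smul, smul_pow]
  -- The series is cut at `N + 1` rather than `N` to match the range of summation of the curve.
  refine ⟨⟨_, hmem⟩, ⟨c • Y, Submodule.smul_mem _ c hY, N + 1, ?_, ?_⟩, by rw [hlax]⟩
  · rw [hpow, pow_succ (D.semiAd (0, Y)), hN, zero_mul, smul_zero, LinearMap.zero_apply]
  · have hterm : ∀ n, ((n.factorial : ℂ)⁻¹) • (D.semiAd (0, c • Y) ^ n) (D.lax k q) =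
        c ^ n • D.expTerm k Y q n := fun n => by
      rw [hpow, LinearMap.smul_apply, smul_comm, expTerm]
    simp only [hterm, hlax]
    refine Prod.ext ?_ ?_
    · rw [Prod.fst_sum, Finset.sum_range_succ', Finset.sum_eq_zero fun n _ => by
        rw [Prod.smul_fst, expTerm_succ_fst, smul_zero], pow_zero, one_smul, expTerm_zero_fst,
        zero_add]
    · rw [Prod.snd_sum]
      rfl

theorem gaugeInvariants_le_W : Subalgebra.toSubmodule (D.gaugeInvariants k) ≤ D.W k := by
  intro P hP
  obtain ⟨A, rfl⟩ := D.quo_surjective P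
  refine ⟨A, fun n hn => D.map_adLambda_eq_zero k (fun i hi j n hni hnj => ?_) hn, rfl⟩
  by_cases hn0 : n = 0
  · rw [hn0, adLambda_zero, LinearMap.zero_apply, Polynomial.map_zero]
  have hnn := D.gr_le_nn hi hni
  have hsum : ∀ F ∈ D.compVI j, ∑ l ∈ Finset.range ((D.adLambda k n A).natDegree + 1),
      (D.derivVI ^ l) F * D.quo ((D.adLambda k n A).coeff l) = 0 := by
    intro F hF
    set q := D.genericPoint
    set Y : D.Cur := n ⊗ₜ F
    have hY : Y ∈ D.evenPart D.nn := D.tmul_mem_evenPart hnn hnj hF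
    obtain ⟨N, hN⟩ := D.isNilpotent_semiAd_tmul hi.ne' hni hF
    have hw : ∀ n, (D.expTerm k Y q n).2 ∈ D.evenPart ⊤ :=
      D.expTerm_snd_mem (D.evenPart_mono le_top hY) (D.evenPart_mono le_top q.2)
    -- For each complex `c` the point `t = c` of the curve is gauge equivalent to the generic point,
    -- so invariance fixes the value there.
    have hconst : D.pathHom N hw A = C (D.eval k q (D.quo A)) := by
      rw [← sub_eq_zero]
      refine eq_zero_of_evalAt_eq_zero fun c => ?_
      obtain ⟨q', hqq', hq'⟩ := D.exists_gaugeEquiv (k := k) q hY hN c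
      rw [map_sub, evalAt_C, D.evalAt_pathHom N hw k c q' hq', hP q q' hqq', sub_self]
    have hNw : D.semiAd (0, Y) (D.expTerm k Y q N) = 0 := by
      rw [expTerm, hN, LinearMap.zero_apply, smul_zero, map_zero]
    have hder := D.derivative_pathHom hw (D.expTerm_succ k Y q) hNw
      (D.isGaugeDerivation_tmul k N hw (D.expTerm_zero_fst k Y q) (D.expTerm_succ_fst k Y q)
        hnj hF) A
    rw [hconst, Polynomial.derivative_C, LinearMap.neg_apply, LinearMap.comp_apply,
      zero_eq_neg, lambdaAct_eq_sum] at hder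
    -- At `t = 0` the curve is at the generic point, so evaluation there is the quotient map; the
    -- vanishing derivative thus becomes a relation among the coefficients of `{n_λ A}` in `V_I(𝔭)`.
    have h0 : ∀ x, evalAt D.VI 0 (D.pathHom N hw x) = D.quo x := fun x => by
      rw [D.evalAt_pathHom N hw k 0 q, eval_genericPoint]
      rw [Finset.sum_range_succ', Finset.sum_eq_zero fun n _ => by rw [zero_pow n.succ_ne_zero,
        zero_smul], pow_zero, one_smul, zero_add, expTerm_zero]
    have := congrArg (evalAt D.VI 0) hder
    simpa only [map_sum, map_mul, evalAt_C, h0, map_zero] using this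
  ext l
  rw [Polynomial.coeff_map, Polynomial.coeff_zero]
  by_cases hl : l < (D.adLambda k n A).natDegree + 1
  · exact D.quo_eq_zero_of_sum_eq_zero hnj hnn hn0 _ (fun l => (D.adLambda k n A).coeff l) hsum hl
  · rw [Polynomial.coeff_eq_zero_of_natDegree_lt (by omega), map_zero]

end Converse

end Setup

end DrinfeldSokolov

theorem theorem3p11 {g : Type*} [AddCommGroup g] [Module ℂ g] [FiniteDimensional ℂ g]
    [DrinfeldSokolov.LieSuperalgebra g] (hg : DrinfeldSokolov.IsSimple g)
    (D : DrinfeldSokolov.Setup g) (k : ℂ) :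
    Subalgebra.toSubmodule (D.gaugeInvariants k) = D.W k :=
  le_antisymm D.gaugeInvariants_le_W D.W_le_gaugeInvariants
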